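/- **Setting.** There are $K\ge 1$ arms and a preference matrix $Q=(q_{ij})\in[0,1]^{K\times K}$ with $q_{ii}=1/2$, $q_{ij}+q_{ji}=1$ and a Condorcet winner, called arm $1$: $q_{1j}>1/2$ for all $j\ne 1$. Put $\Delta_{1j}=q_{1j}-1/2$, $\Delta_{1\max}=\max_j\Delta_{1j}$, and for $i\neq j$ put $\overline\Delta_{1j}=\overline\Delta_{j1}=\Delta_{1j}$, $\overline\Delta_{ij}=\min\{\Delta_{1i},\Delta_{1j}\}$ if $i,j\ne1$; put $\mathcal D=\sum_{i<j}4\alpha/\overline\Delta_{ij}^2$. There are $M$ players, the vertices of a connected graph $\mathcal G$ with distance $d$. For an integer $\gamma\ge0$, $\mathcal G_\gamma$ is the graph in which distinct players at distance at most $\gamma$ are adjacent; $\chi(\mathcal G_\gamma)$ is the least number of cliques of $\mathcal G_\gamma$ that contain all vertices, $d^\gamma_{\max}$ is its maximal degree, and $\Gamma(m,\gamma')$ is the size of the largest clique of $\mathcal G_{\gamma'}$ that contains $m$. **Algorithm (message-passing RUCB with parameters $\alpha,\gamma$).** In round $t$ each player $m$ draws a pair $(i_m(t),j_m(t))$ and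 sees a Bernoulli$(q_{i_m(t)j_m(t)})$ reward, the indicator that $i_m(t)$ wins; given the past, the players act independently. The message (pair and reward) of player $m'$ in round $t'$ reaches $m$ at the end of round $t'+\max\{d(m,m')-1,0\}$ if $d(m,m')\le\gamma$, and never otherwise; a player has its own samples at once. Let $\tilde w^m_{ij}$ be the number of wins of $i$ over $j$ known to $m$ before round $t$ and $\tilde N^m_{ij}=\tilde w^m_{ij}+\tilde w^m_{ji}$. With the convention $x/0=1$ let $u^m_{ij}=\tilde w^m_{ij}/\tilde N^m_{ij}+\sqrt{\alpha\log t/\tilde N^m_{ij}}$ for $i\ne j$, and $u^m_{ii}=1/2$. Let $\mathcal C^m=\{i: u^m_{ij}\ge 1/2\ \forall j\}$, and let $\mathcal B^m_{\rm rec}$ be the set of arms $i$ such that a message received by $m$ at the end of round $t-1$ reports a draw of $(i,i)$. The candidate set $\mathcal B^m$ (initially empty) is replaced by $\mathcal B^m\cap\mathcal C^m$; if $|\mathcal C^m|=1$ it is then set to $\mathcal C^m$; if $\mathcal B^m_{\rm rec}\cap\mathcal C^m\neq\emptyset$ it is then set to $\{i\}$ with $i$ uniform on $\mathcal B^m_{\rm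 rec}\cap\mathcal C^m$. The arm $i_m(t)$ is uniform on $[K]$ if $\mathcal C^m=\emptyset$, is taken from $\mathcal B^m$ if $\mathcal B^m\cap\mathcal C^m\ne\emptyset$, and is uniform on $\mathcal C^m$ otherwise. The arm $j_m(t)$ maximizes $j\mapsto u^m_{j\,i_m(t)}$; it is different from $i_m(t)$ if some maximizer is, and further ties are resolved by an arbitrary, possibly random, rule depending on the player, the round and the set of tied arms. The group regret is $\mathcal R(T)=\sum_{m=1}^M\sum_{t=1}^T\frac12(\Delta_{1i_m(t)}+\Delta_{1j_m(t)})$. **Theorem.** Let $S=MK^2(3+2\log(d^\gamma_{\max}+1))$ and $L(T)=\sum_{j>1}\frac{2\alpha\,\chi(\mathcal G_\gamma)}{\Delta_{1j}}\log T$. (i) For every $\alpha>2.4/1.7\;(\approx1.41)$ and all $T$, $\mathbb E\mathcal R(T)\le L(T)+\hat C$, where $$\hat C=\Delta_{1\max}\sum_{m=1}^M\min_{0\le\gamma'\le\gamma}\Big(K^2(\gamma'+2)+\frac{2\mathcal D}{\Gamma(m,\gamma')}\log 2\mathcal D\Big)+(2\tilde C+K(3\gamma+2))M\Delta_{1\max},\qquad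 \tilde C=\frac{1.7\alpha-1.4}{1.7\alpha-2.4}\,(4S)^{\frac1{1.7\alpha-1.4}}.$$ For $\varepsilon>0$, $\eta>1$ put $x=2\alpha\eta^{-1/2}-1-\varepsilon$ and $B=\dfrac{S}{\min\{1,2\alpha\eta^{-1/2}-1\}\log\eta}$; let $T_\varepsilon=(-W_{-1}(-\varepsilon)/\varepsilon)^{1/\varepsilon}$ if $\varepsilon<e^{-1}$ ($W_{-1}$ the lower real Lambert branch) and $T_\varepsilon=0$ otherwise; for $\delta>0$ put $C_\varepsilon(\delta)=\max\{e^{1/\varepsilon},T_\varepsilon,(B/\delta)^{1/x}\}$, put $\tilde C_\varepsilon=\max\{T_\varepsilon,e^{1/\varepsilon}\}+\frac{x}{x-1}B^{1/x}$, and for a number $c$ $$\hat C'(c)=\Delta_{1\max}\sum_{m=1}^M\min_{0\le\gamma'\le\gamma}\Big(K^2(\gamma'+2)+\frac{2\mathcal D}{\Gamma(m,\gamma')}\log\frac{2\mathcal D}{\Gamma(m,\gamma')}\Big)+(2c+K(3\gamma+2))M\Delta_{1\max}.$$ (ii) For all $\varepsilon>0$, $\eta>1$, $\delta>0$, $\alpha>0.5\sqrt\eta(1+\varepsilon)$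 and all $T$, with probability larger than $1-\delta$, $\mathcal R(T)\le L(T)+\hat C'(C_\varepsilon(\delta))$. (iii) For all $\varepsilon>0$, $\eta>1$, $\alpha>0.5\sqrt\eta(2+\varepsilon)$ and all $T$, $\mathbb E\mathcal R(T)\le L(T)+\hat C'(\tilde C_\varepsilon)$. (With $\varepsilon=e^{-1}$, $\eta=1.3$ this covers every $\alpha>1.4$.) -/

import Mathlib

open scoped ENNReal

noncomputable section

namespace MPDueling

/-! ### Power graphs, cliques and clique coverings -/

/-- The `γ`-power of `G`: distinct vertices at distance at most `γ` in `G` are adjacent. -/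
def powerGraph {V : Type} (G : SimpleGraph V) (γ : ℕ) : SimpleGraph V where
  Adj u v := u ≠ v ∧ G.edist u v ≤ γ
  symm := ⟨fun _ _ h => ⟨h.1.symm, by rw [SimpleGraph.edist_comm]; exact h.2⟩⟩
  loopless := ⟨fun _ h => h.1 rfl⟩

open Classical in
/-- The size of the largest clique of `G` that contains the vertex `v`. -/
def maxCliqueAt {V : Type} [Fintype V] (G : SimpleGraph V) (v : V) : ℕ :=
  (Finset.univ.filter (fun s : Finset V => v ∈ s ∧ G.IsClique (s : Set V))).sup Finset.card

/-- The clique covering number: the least number of cliques that together contain every vertex. -/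
def cliqueCoverNumber {V : Type} (G : SimpleGraph V) : ℕ :=
  sInf {n | ∃ 𝒮 : Finset (Finset V), 𝒮.card = n ∧
    (∀ s ∈ 𝒮, G.IsClique (s : Set V)) ∧ ∀ v, ∃ s ∈ 𝒮, v ∈ s}

open Classical in
/-- The maximal vertex degree. -/
def maxDeg {V : Type} [Fintype V] (G : SimpleGraph V) : ℕ := G.maxDegree

/-! ### Dueling bandit instances with a Condorcet winner -/

/-- A preference matrix `q` on `K` arms together with its Condorcet winner `cw`. -/
structure Instance (K : ℕ) where
  q : Fin K → Fin K → ℝ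
  cw : Fin K
  q_nonneg : ∀ i j, 0 ≤ q i j
  q_self : ∀ i, q i i = 1 / 2
  q_add_swap : ∀ i j, q i j + q j i = 1
  cw_wins : ∀ j, j ≠ cw → 1 / 2 < q cw j

namespace Instance

variable {K : ℕ} (Q : Instance K)

theorem q_le_one (i j : Fin K) : Q.q i j ≤ 1 := by
  have h1 := Q.q_add_swap i j
  have h2 := Q.q_nonneg j i
  linarith

/-- The gap of the arm `j` with respect to the Condorcet winner. -/
def gap (j : Fin K) : ℝ := Q.q Q.cw j - 1 / 2

/-- The largest gap. -/
def gapMax : ℝ := Finset.univ.sup' ⟨Q.cw, Finset.mem_univ _⟩ Q.gap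

/-- The effective gap of a pair of distinct arms: the smaller of the two gaps if neither arm is the
Condorcet winner, and the gap of the other arm if one of them is. -/
def pairGap (i j : Fin K) : ℝ :=
  if i = Q.cw then Q.gap j else if j = Q.cw then Q.gap i else min (Q.gap i) (Q.gap j)

/-- The sum of `4 α / pairGap ^ 2` over all unordered pairs of distinct arms. -/
def pairSum (α : ℝ) : ℝ :=
  ∑ i : Fin K, ∑ j ∈ Finset.univ.filter (fun j => i < j), 4 * α / Q.pairGap i j ^ 2

/-- The law of the outcome of a duel: `true` means that the first arm wins. -/
def duel (i j : Fin K) : PMF Bool :=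
  PMF.ofFintype (fun b => if b then ENNReal.ofReal (Q.q i j) else ENNReal.ofReal (1 - Q.q i j)) (by
    rw [Fintype.sum_bool]
    simp only [if_true, Bool.false_eq_true, if_false]
    rw [← ENNReal.ofReal_add (Q.q_nonneg i j) (by linarith [Q.q_le_one i j])]
    simp)

end Instance

/-! ### Finite probability -/

/-- The law of a family of independent random elements with prescribed laws. -/
def indep {ι β : Type} [Fintype ι] [Fintype β] (p : ι → PMF β) : PMF (ι → β) := by
  classical
  exact PMF.ofFintype (fun f => ∏ i, p i (f i)) (by
    rw [← Fintype.piFinset_univ, ← Finset.prod_univ_sum]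
    refine Finset.prod_eq_one fun i _ => ?_
    rw [← tsum_fintype (L := SummationFilter.unconditional β)]
    exact (p i).tsum_coe)

/-- The expectation of `f` under a law on a finite type. -/
def expect {β : Type} [Fintype β] (p : PMF β) (f : β → ℝ) : ℝ := ∑ b, (p b).toReal * f b

/-- The probability of the event `A` under a law on a finite type. -/
def prob {β : Type} (p : PMF β) (A : Set β) : ℝ := (p.toOuterMeasure A).toReal

/-- A uniformly random element of the finite set `S` of arms (only used for nonempty `S`). -/
def pick {K : ℕ} [NeZero K] (S : Finset (Fin K)) : PMF (Fin K) := by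
  classical
  exact if h : S.Nonempty then PMF.uniformOfFinset S h else PMF.uniformOfFintype (Fin K)

/-! ### The message-passing RUCB algorithm -/

/-- What is recorded for one player in one round: the candidate set held by the player when it draws
its arms, the ordered pair of arms drawn, and whether the first arm won. -/
abbrev Entry (K : ℕ) : Type := Finset (Fin K) × Fin K × Fin K × Bool

namespace Entry

variable {K : ℕ}

def cand (e : Entry K) : Finset (Fin K) := e.1
def fst (e : Entry K) : Fin K := e.2.1
def snd (e : Entry K) : Fin K := e.2.2.1
def win (e : Entry K) : Bool := e.2.2.2

/-- In this entry the arm `i` won a duel against the arm `j`. -/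
def Beats (e : Entry K) (i j : Fin K) : Prop :=
  (fst e = i ∧ snd e = j ∧ win e = true) ∨ (fst e = j ∧ snd e = i ∧ win e = false)

end Entry

/-- The complete record of the first `t` rounds of `M` players; index `s` stands for round `s + 1`. -/
abbrev History (M K t : ℕ) : Type := Fin t → Fin M → Entry K

section Algorithm

variable {M K : ℕ}

/-- The number of rounds by which a message is delayed between `m` and `m'`: a message of a neighbour
(and a player's own sample) is available at the end of the round in which it is sent. -/
def delay (G : SimpleGraph (Fin M)) (m m' : Fin M) : ℕ := G.dist m m' - 1

/-- At the end of round `t`, player `m` has received the message that player `m'` sent in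
round `s + 1`. -/
def Received (G : SimpleGraph (Fin M)) (γ : ℕ) (m m' : Fin M) {t : ℕ} (s : Fin t) : Prop :=
  G.edist m m' ≤ γ ∧ (s : ℕ) + 1 + delay G m m' ≤ t

/-- The message that player `m'` sent in round `s + 1` reaches player `m` exactly in round `t`. -/
def JustReceived (G : SimpleGraph (Fin M)) (γ : ℕ) (m m' : Fin M) {t : ℕ} (s : Fin t) : Prop :=
  G.edist m m' ≤ γ ∧ (s : ℕ) + 1 + delay G m m' = t

open Classical in
/-- The number of wins of arm `i` over arm `j` known to player `m` at the end of round `t`. -/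
def knownWins (G : SimpleGraph (Fin M)) (γ : ℕ) {t : ℕ} (h : History M K t) (m : Fin M)
    (i j : Fin K) : ℕ :=
  ∑ m' : Fin M, ∑ s : Fin t, if Received G γ m m' s ∧ (h s m').Beats i j then 1 else 0

/-- The number of duels between `i` and `j` known to player `m` at the end of round `t`. -/
def knownDuels (G : SimpleGraph (Fin M)) (γ : ℕ) {t : ℕ} (h : History M K t) (m : Fin M)
    (i j : Fin K) : ℕ :=
  knownWins G γ h m i j + knownWins G γ h m j i

/-- Division with the convention `x / 0 = 1` for every `x`. -/
def div1 (x y : ℝ) : ℝ := if y = 0 then 1 else x / y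

/-- The upper confidence terms used by player `m` in round `t + 1`. -/
def ucb (G : SimpleGraph (Fin M)) (γ : ℕ) (α : ℝ) {t : ℕ} (h : History M K t) (m : Fin M)
    (i j : Fin K) : ℝ :=
  if i = j then 1 / 2 else
    div1 (knownWins G γ h m i j) (knownDuels G γ h m i j) +
      √(div1 (α * Real.log ((t : ℝ) + 1)) (knownDuels G γ h m i j))

open Classical in
/-- The champion set of player `m` in round `t + 1`. -/
def champions (G : SimpleGraph (Fin M)) (γ : ℕ) (α : ℝ) {t : ℕ} (h : History M K t)
    (m : Fin M) : Finset (Fin K) :=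
  Finset.univ.filter fun i => ∀ j, 1 / 2 ≤ ucb G γ α h m i j

open Classical in
/-- The arms recommended to player `m` by the messages received in round `t`. -/
def recommended (G : SimpleGraph (Fin M)) (γ : ℕ) {t : ℕ} (h : History M K t)
    (m : Fin M) : Finset (Fin K) :=
  Finset.univ.filter fun i => ∃ (m' : Fin M) (s : Fin t),
    JustReceived G γ m m' s ∧ (h s m').fst = i ∧ (h s m').snd = i

/-- The candidate set of player `m` at the end of round `t` (initially empty). -/
def lastCand : {t : ℕ} → History M K t → Fin M → Finset (Fin K)
  | 0, _, _ => ∅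
  | t + 1, h, m => (h (Fin.last t) m).cand

/-- The update of the candidate set of player `m` in round `t + 1`. -/
def newCand [NeZero K] (G : SimpleGraph (Fin M)) (γ : ℕ) (α : ℝ) {t : ℕ} (h : History M K t)
    (m : Fin M) : PMF (Finset (Fin K)) :=
  let C := champions G γ α h m
  let R := recommended G γ h m ∩ C
  if R.Nonempty then (pick R).map (fun i => {i})
  else PMF.pure (if C.card = 1 then C else lastCand h m ∩ C)

/-- The draw of the first arm from the champion set `C` and the candidate set `B`. -/
def firstArm [NeZero K] (C B : Finset (Fin K)) : PMF (Fin K) :=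
  if C = ∅ then pick Finset.univ
  else if (B ∩ C).Nonempty then pick B
  else pick C

/-- A rule for resolving remaining ties: for each player, each round and each set of tied arms, the
law of the arm that is drawn. -/
abbrev TieRule (M K : ℕ) : Type := Fin M → ℕ → Finset (Fin K) → PMF (Fin K)

/-- A tie rule always draws one of the tied arms. -/
def TieRule.Valid (tie : TieRule M K) : Prop :=
  ∀ m t (S : Finset (Fin K)), S.Nonempty → ∀ j ∈ (tie m t S).support, j ∈ S

open Classical in
/-- The arms `j` that maximize `u j i`. -/
def maximizers (u : Fin K → Fin K → ℝ) (i : Fin K) : Finset (Fin K) :=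
  Finset.univ.filter fun j => ∀ k, u k i ≤ u j i

/-- The draw of the second arm in round `t + 1` given the first arm `i`: a maximizer of `u j i`, and
one different from `i` if there is one. -/
def secondArm (tie : TieRule M K) (m : Fin M) (t : ℕ) (u : Fin K → Fin K → ℝ) (i : Fin K) :
    PMF (Fin K) :=
  if ((maximizers u i).erase i).Nonempty then tie m (t + 1) ((maximizers u i).erase i)
  else PMF.pure i

/-- Round `t + 1` of player `m`, given the record of the first `t` rounds. -/
def playRound [NeZero K] (Q : Instance K) (G : SimpleGraph (Fin M)) (γ : ℕ) (α : ℝ)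
    (tie : TieRule M K) {t : ℕ} (h : History M K t) (m : Fin M) : PMF (Entry K) :=
  (newCand G γ α h m).bind fun B =>
  (firstArm (champions G γ α h m) B).bind fun i =>
  (secondArm tie m t (ucb G γ α h m) i).bind fun j =>
  (Q.duel i j).bind fun r =>
  PMF.pure (B, i, j, r)

/-- The law of the first `T` rounds of the algorithm: given the past, the players act independently
in each round. -/
def law [NeZero K] (Q : Instance K) (G : SimpleGraph (Fin M)) (γ : ℕ) (α : ℝ)
    (tie : TieRule M K) : (T : ℕ) → PMF (History M K T)
  | 0 => PMF.pure Fin.elim0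
  | T + 1 => (law Q G γ α tie T).bind fun h =>
      (indep fun m => playRound Q G γ α tie h m).map fun e =>
        (Fin.snoc h e : History M K (T + 1))

/-- The group regret of a record. -/
def regret (Q : Instance K) {T : ℕ} (h : History M K T) : ℝ :=
  ∑ m : Fin M, ∑ t : Fin T, (1 / 2) * (Q.gap (h t m).fst + Q.gap (h t m).snd)

/-- The expected group regret after `T` rounds. -/
def expectedRegret [NeZero K] (Q : Instance K) (G : SimpleGraph (Fin M)) (γ : ℕ) (α : ℝ)
    (tie : TieRule M K) (T : ℕ) : ℝ :=
  expect (law Q G γ α tie T) (regret Q)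

end Algorithm

/-! ### The terms of the bound -/

section Bounds

variable {M K : ℕ}

/-- The leading, logarithmic term of the bound. -/
def leadTerm (Q : Instance K) (G : SimpleGraph (Fin M)) (γ : ℕ) (α : ℝ) (T : ℕ) : ℝ :=
  (∑ j ∈ Finset.univ.erase Q.cw,
    2 * α * (cliqueCoverNumber (powerGraph G γ) : ℝ) / Q.gap j) * Real.log T

/-- The quantity `M K² (3 + 2 log (d + 1))`, with `d` the maximal degree of the `γ`-power graph. -/
def sizeTerm (K : ℕ) (G : SimpleGraph (Fin M)) (γ : ℕ) : ℝ :=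
  (M : ℝ) * (K : ℝ) ^ 2 * (3 + 2 * Real.log ((maxDeg (powerGraph G γ) : ℝ) + 1))

/-- The finite-time term, with the logarithmic factor `log (2 𝒟)` and the burn-in constant `c`. -/
def finiteTerm (Q : Instance K) (G : SimpleGraph (Fin M)) (γ : ℕ) (α c : ℝ) : ℝ :=
  Q.gapMax * (∑ m : Fin M, (Finset.range (γ + 1)).inf' ⟨0, by simp⟩ fun γ' : ℕ =>
      (K : ℝ) ^ 2 * ((γ' : ℝ) + 2) +
        2 * Q.pairSum α / (maxCliqueAt (powerGraph G γ') m : ℝ) * Real.log (2 * Q.pairSum α))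
    + (2 * c + (K : ℝ) * (3 * (γ : ℝ) + 2)) * (M : ℝ) * Q.gapMax

/-- The finite-time term, with the smaller logarithmic factor `log (2 𝒟 / Γ)` and the burn-in
constant `c`. -/
def finiteTerm' (Q : Instance K) (G : SimpleGraph (Fin M)) (γ : ℕ) (α c : ℝ) : ℝ :=
  Q.gapMax * (∑ m : Fin M, (Finset.range (γ + 1)).inf' ⟨0, by simp⟩ fun γ' : ℕ =>
      (K : ℝ) ^ 2 * ((γ' : ℝ) + 2) +
        2 * Q.pairSum α / (maxCliqueAt (powerGraph G γ') m : ℝ) *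
          Real.log (2 * Q.pairSum α / (maxCliqueAt (powerGraph G γ') m : ℝ)))
    + (2 * c + (K : ℝ) * (3 * (γ : ℝ) + 2)) * (M : ℝ) * Q.gapMax

/-- The burn-in constant for the expected regret. -/
def Ctilde (K : ℕ) (G : SimpleGraph (Fin M)) (γ : ℕ) (α : ℝ) : ℝ :=
  (1.7 * α - 1.4) / (1.7 * α - 2.4) * (4 * sizeTerm K G γ) ^ (1 / (1.7 * α - 1.4))

/-- The lower real branch of the Lambert function: for `-1/e ≤ x < 0`, the only `w ≤ -1` with
`w e ^ w = x`. -/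
def lambertNeg (x : ℝ) : ℝ := sInf {w : ℝ | w ≤ -1 ∧ w * Real.exp w = x}

/-- The threshold after which `log t ≤ t ^ ε`. -/
def Teps (ε : ℝ) : ℝ :=
  if ε < Real.exp (-1) then (-lambertNeg (-ε) / ε) ^ (1 / ε) else 0

/-- The exponent `2 α η^{-1/2} - 1 - ε`. -/
def expo (α ε η : ℝ) : ℝ := 2 * α * η ^ (-(1 / 2) : ℝ) - 1 - ε

/-- The fraction `M K² (3 + 2 log (d + 1)) / (min {1, 2 α η^{-1/2} - 1} log η)`. -/
def baseEps (K : ℕ) (G : SimpleGraph (Fin M)) (γ : ℕ) (α η : ℝ) : ℝ :=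
  sizeTerm K G γ / (min 1 (2 * α * η ^ (-(1 / 2) : ℝ) - 1) * Real.log η)

/-- The burn-in constant at confidence level `δ`. -/
def Ceps (K : ℕ) (G : SimpleGraph (Fin M)) (γ : ℕ) (α ε η δ : ℝ) : ℝ :=
  max (max (Real.exp (1 / ε)) (Teps ε)) ((baseEps K G γ α η / δ) ^ (1 / expo α ε η))

/-- The general burn-in constant for the expected regret. -/
def CtildeEps (K : ℕ) (G : SimpleGraph (Fin M)) (γ : ℕ) (α ε η : ℝ) : ℝ :=
  max (Teps ε) (Real.exp (1 / ε)) +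
    expo α ε η / (expo α ε η - 1) * baseEps K G γ α η ^ (1 / expo α ε η)

end Bounds

end MPDueling

end

/-!
On a record on which all confidence terms are correct after some round `c`, the regret is bounded
deterministically (`regret_le`). From then on the Condorcet winner is always a champion, no other arm
is drawn against itself, and a pair of distinct arms is drawn only while few of its duels are known to
the player (`Correct.knownDuels_le`). Since messages inside a clique of the `γ'`-power graph are
delayed by less than `max γ' 1` rounds, the members of a clique together make hardly more draws of a
pair than a single player would (`card_duels_le`). Two consequences follow. A player whose candidate
set is not yet the Condorcet winner alone has heard of no duel of an arm against itself, so all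
players of a clique around it have been duelling distinct arms, and the logarithmic number of such
duels bounds the waiting time (`round_le_waitBound`). Afterwards the first arm is the Condorcet winner,
and only its duels against the other arms cost regret; counted over a clique cover
(`card_duels_le_cliqueCover`), they give the leading term.

The probability that some confidence term fails after round `c` is summed over rounds, players and
pairs. In one round, the number `N` of known duels lies in one of logarithmically many geometric
slices; on each slice Markov's inequality applies to the exponential moment of the deviation of the
wins, whose expectation is at most one because outcomes are conditionally independent given the past
(`expect_exp_known_le_one`, `prob_ucb_lt_slice`). The ratio of the slices is chosen in terms of `η`:
for moderate `η` the ratio `η ^ 2` already achieves the exponent `2 α / √η`; for large `η` the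
ratio `η` achieves twice that exponent, and the width of the confidence terms excludes failures unless
`log η` is at most of the order of the logarithm of the number of duels. The tail sum over rounds is
compared with an integral (`prob_not_correctAfter_lt`). This gives the high probability bound
directly. The pathwise bound is affine in `c`, so the last failing round can replace `c` in
expectation (`expectedRegret_le_of_tail`), and its expectation is the integral of the tail.
-/

namespace MPDueling

/-! ### Expectations over finite laws -/

section FiniteProbability

variable {β δ : Type} [Fintype β] [Fintype δ]

theorem sum_toReal (p : PMF β) : ∑ b, (p b).toReal = 1 := by
  rw [← ENNReal.toReal_sum fun b _ => p.apply_ne_top b,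
    ← tsum_fintype (L := SummationFilter.unconditional β), p.tsum_coe, ENNReal.toReal_one]

theorem expect_const (p : PMF β) (c : ℝ) : expect p (fun _ => c) = c := by
  rw [expect, ← Finset.sum_mul, sum_toReal, one_mul]

theorem expect_add (p : PMF β) (f g : β → ℝ) :
    expect p (fun b => f b + g b) = expect p f + expect p g := by
  simp [expect, mul_add, Finset.sum_add_distrib]

theorem expect_const_mul (p : PMF β) (c : ℝ) (f : β → ℝ) :
    expect p (fun b => c * f b) = c * expect p f := by
  simp only [expect, Finset.mul_sum]
  exact Finset.sum_congr rfl fun b _ => by ring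

theorem expect_sum {ι : Type} (p : PMF β) (s : Finset ι) (f : ι → β → ℝ) :
    expect p (fun b => ∑ i ∈ s, f i b) = ∑ i ∈ s, expect p (f i) := by
  simp only [expect, Finset.mul_sum]
  exact Finset.sum_comm

theorem expect_mono_of_support {p : PMF β} {f g : β → ℝ} (h : ∀ b ∈ p.support, f b ≤ g b) :
    expect p f ≤ expect p g := by
  refine Finset.sum_le_sum fun b _ => ?_
  by_cases hb : b ∈ p.support
  · exact mul_le_mul_of_nonneg_left (h b hb) ENNReal.toReal_nonneg
  · rw [PMF.apply_eq_zero_iff p b |>.2 hb]; simp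

theorem expect_mono {p : PMF β} {f g : β → ℝ} (h : ∀ b, f b ≤ g b) : expect p f ≤ expect p g :=
  expect_mono_of_support fun b _ => h b

theorem expect_pure (b : β) (f : β → ℝ) : expect (PMF.pure b) f = f b := by
  classical
  rw [expect, Finset.sum_eq_single b] <;> simp +contextual [PMF.pure_apply]

theorem expect_bind (p : PMF β) (k : β → PMF δ) (f : δ → ℝ) :
    expect (p.bind k) f = expect p fun b => expect (k b) f := by
  have h : ∀ d, ((p.bind k) d).toReal = ∑ b, (p b).toReal * (k b d).toReal := fun d => by
    rw [PMF.bind_apply, tsum_fintype, ENNReal.toReal_sum fun b _ =>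
      ENNReal.mul_ne_top (p.apply_ne_top b) ((k b).apply_ne_top d)]
    simp only [ENNReal.toReal_mul]
  simp only [expect, h, Finset.sum_mul, Finset.mul_sum]
  rw [Finset.sum_comm]
  exact Finset.sum_congr rfl fun b _ => Finset.sum_congr rfl fun d _ => by ring

theorem expect_map (p : PMF β) (g : β → δ) (f : δ → ℝ) :
    expect (p.map g) f = expect p fun b => f (g b) := by
  rw [← PMF.bind_pure_comp, expect_bind]
  simp only [Function.comp, expect_pure]

theorem indep_apply {ι : Type} [Fintype ι] (p : ι → PMF β) (e : ι → β) :
    indep p e = ∏ i, p i (e i) := by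
  simp [indep]

theorem expect_indep_prod {ι : Type} [Fintype ι] [DecidableEq ι] (p : ι → PMF β)
    (g : ι → β → ℝ) :
    expect (indep p) (fun e => ∏ i, g i (e i)) = ∏ i, expect (p i) (g i) := by
  simp only [expect, indep_apply, ENNReal.toReal_prod, ← Finset.prod_mul_distrib]
  rw [Finset.prod_univ_sum, Fintype.piFinset_univ]

theorem mem_support_of_mem_support_indep {ι : Type} [Fintype ι] {p : ι → PMF β} {e : ι → β}
    (he : e ∈ (indep p).support) (i : ι) : e i ∈ (p i).support := by
  rw [PMF.mem_support_iff, indep_apply, Finset.prod_ne_zero_iff] at he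
  exact (PMF.mem_support_iff _ _).2 (he i (Finset.mem_univ i))

open Classical in
theorem prob_eq_expect (p : PMF β) (A : Set β) :
    prob p A = expect p fun b => if b ∈ A then 1 else 0 := by
  rw [prob, PMF.toOuterMeasure_apply, tsum_fintype,
    ENNReal.toReal_sum fun b _ => (lt_of_le_of_lt (Set.indicator_le_self _ _ b)
      (p.apply_lt_top b)).ne]
  refine Finset.sum_congr rfl fun b _ => ?_
  by_cases hb : b ∈ A <;> simp [hb]

theorem prob_le_expect {p : PMF β} {A : Set β} {f : β → ℝ} (h0 : ∀ b, 0 ≤ f b)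
    (h1 : ∀ b ∈ A, 1 ≤ f b) : prob p A ≤ expect p f := by
  classical
  rw [prob_eq_expect]
  refine expect_mono fun b => ?_
  split_ifs with hb
  exacts [h1 b hb, h0 b]

theorem prob_mono_of_support {p : PMF β} {A B : Set β} (h : ∀ b ∈ p.support, b ∈ A → b ∈ B) :
    prob p A ≤ prob p B := by
  classical
  rw [prob_eq_expect, prob_eq_expect]
  refine expect_mono_of_support fun b hb => ?_
  by_cases hA : b ∈ A
  · simp [hA, h b hb hA]
  · simp only [hA, if_false]; split_ifs <;> norm_num

theorem prob_compl (p : PMF β) (A : Set β) : prob p Aᶜ = 1 - prob p A := by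
  classical
  rw [prob_eq_expect, prob_eq_expect, eq_sub_iff_add_eq, ← expect_add]
  refine Eq.trans ?_ (expect_const p 1)
  congr 1
  ext b
  by_cases hb : b ∈ A <;> simp [hb]

theorem prob_le_sum {ι : Type} {p : PMF β} {A : Set β} (s : Finset ι) (E : ι → Set β)
    (h : ∀ b ∈ A, ∃ i ∈ s, b ∈ E i) : prob p A ≤ ∑ i ∈ s, prob p (E i) := by
  classical
  simp only [prob_eq_expect p (E _), ← expect_sum]
  refine prob_le_expect (fun b => Finset.sum_nonneg fun i _ => by split_ifs <;> norm_num)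
    fun b hb => ?_
  obtain ⟨i, hi, hbi⟩ := h b hb
  refine le_trans (by simp [hbi]) (Finset.single_le_sum (f := fun i => if b ∈ E i then (1 : ℝ) else 0)
    (fun i _ => by split_ifs <;> norm_num) hi)

/-- A tail bound of power type for a random variable bounds its expectation. -/
theorem expect_le_of_tail (p : PMF β) (X : β → ℝ) {s x B : ℝ} (hs : 0 < s) (hx : 1 < x)
    (hB : 0 ≤ B) (htail : ∀ u, s ≤ u → prob p {b | u < X b} ≤ B * u ^ (-x)) :
    expect p X ≤ s + B * s ^ (1 - x) / (x - 1) := by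
  classical
  obtain ⟨R, hR⟩ : ∃ R, s ≤ R ∧ ∀ b, X b ≤ R := by
    obtain ⟨R, hR⟩ := (Set.finite_range X).bddAbove
    exact ⟨max s R, le_max_left _ _, fun b => (hR ⟨b, rfl⟩).trans (le_max_right _ _)⟩
  let I : β → ℝ → ℝ := fun b u => if u < X b then 1 else 0
  have hI : ∀ b, IntervalIntegrable (I b) MeasureTheory.volume s R := fun b => by
    refine AntitoneOn.intervalIntegrable fun u _ v _ huv => ?_
    simp only [I]
    split_ifs with h1 h2
    · exact le_rfl
    · exact absurd (huv.trans_lt h1) h2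
    · norm_num
    · exact le_rfl
  have hXI : ∀ b, X b ≤ s + ∫ u in s..R, I b u := fun b => by
    have hnn : ∀ u, 0 ≤ I b u := fun u => by simp only [I]; split_ifs <;> norm_num
    rcases le_or_gt (X b) s with h | h
    · linarith [intervalIntegral.integral_nonneg (μ := MeasureTheory.volume) hR.1
        fun u _ => hnn u]
    · have h1 : ∫ u in s..X b, (1 : ℝ) ≤ ∫ u in s..X b, I b u := by
        refine intervalIntegral.integral_mono_on_of_le_Ioo h.le (by simp) ?_ fun u hu => ?_
        · exact (hI b).mono_set (by
            rw [Set.uIcc_of_le h.le, Set.uIcc_of_le hR.1]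
            exact Set.Icc_subset_Icc_right (hR.2 b))
        · simp [I, hu.2]
      have h2 : ∫ u in s..X b, I b u ≤ ∫ u in s..R, I b u :=
        intervalIntegral.integral_mono_interval le_rfl h.le (hR.2 b)
          (Filter.Eventually.of_forall hnn) (hI b)
      rw [intervalIntegral.integral_const, smul_eq_mul, mul_one] at h1
      linarith
  have hsum : expect p (fun b => ∫ u in s..R, I b u) = ∫ u in s..R, prob p {b | u < X b} := by
    simp only [prob_eq_expect, expect, Set.mem_ofPred_eq]
    rw [intervalIntegral.integral_finsetSum fun b _ => (hI b).const_mul _]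
    simp only [intervalIntegral.integral_const_mul, I]
  have h0 : (0 : ℝ) ∉ Set.uIcc s R := by
    rw [Set.uIcc_of_le hR.1]; exact fun h => absurd h.1 (not_le.2 hs)
  have hpow : ∫ u in s..R, B * u ^ (-x) ≤ B * s ^ (1 - x) / (x - 1) := by
    rw [intervalIntegral.integral_const_mul, integral_rpow (Or.inr ⟨by linarith, h0⟩)]
    have h1 : 0 ≤ R ^ (1 - x) := Real.rpow_nonneg (hs.le.trans hR.1) _
    have h2 : (R ^ (-x + 1) - s ^ (-x + 1)) / (-x + 1) = (s ^ (1 - x) - R ^ (1 - x)) / (x - 1) := by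
      rw [show -x + 1 = 1 - x by ring, ← neg_sub x 1, div_neg, ← neg_div, neg_sub]
    rw [h2, mul_div_assoc]
    gcongr
    linarith
  have hmono : ∫ u in s..R, prob p {b | u < X b} ≤ ∫ u in s..R, B * u ^ (-x) := by
    refine intervalIntegral.integral_mono_on hR.1 ?_ ?_ fun u hu => htail u hu.1
    · simp only [prob_eq_expect, expect, Set.mem_ofPred_eq]
      refine (IntervalIntegrable.sum Finset.univ
        fun b _ => (hI b).const_mul ((p b).toReal)).congr (fun u _ => ?_)
      simp [I]
    · exact (intervalIntegral.intervalIntegrable_rpow (Or.inr h0)).const_mul _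
  calc expect p X ≤ expect p (fun b => s + ∫ u in s..R, I b u) := expect_mono hXI
    _ = s + ∫ u in s..R, prob p {b | u < X b} := by rw [expect_add, expect_const, hsum]
    _ ≤ _ := by linarith

end FiniteProbability

/-! ### The exponential moment of the known duels -/

/-- Hoeffding's lemma for a centred Bernoulli variable. -/
theorem bernoulli_exp_moment_le {K : ℕ} (Q : Instance K) (i j : Fin K) (l : ℝ) :
    expect (Q.duel i j) (fun r => Real.exp (l * (if r then 1 else 0) - l * Q.q i j)) ≤
      Real.exp (l ^ 2 / 8) := by
  have hint : ∀ f : Bool → ℝ, ∫ r, f r ∂(Q.duel i j).toMeasure = expect (Q.duel i j) f := fun f => by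
    rw [PMF.integral_eq_sum]; rfl
  have hmean : ∫ r, (if r then (1 : ℝ) else 0) ∂(Q.duel i j).toMeasure = Q.q i j := by
    rw [hint]
    simp [expect, Instance.duel, ENNReal.toReal_ofReal (Q.q_nonneg i j)]
  have h := (ProbabilityTheory.hasSubgaussianMGF_of_mem_Icc (μ := (Q.duel i j).toMeasure)
    (X := fun r : Bool => if r then (1 : ℝ) else 0) (a := 0) (b := 1)
    (measurable_of_finite _).aemeasurable
    (Filter.Eventually.of_forall fun r => by cases r <;> simp)).mgf_le l
  rw [hmean, ProbabilityTheory.mgf, hint] at h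
  refine le_trans (le_of_eq ?_) (h.trans (le_of_eq ?_))
  · congr 1; ext r; rw [mul_sub]
  · congr 1
    norm_num
    ring

section Moment

variable {M K : ℕ}

theorem expect_playRound [NeZero K] (Q : Instance K) (G : SimpleGraph (Fin M)) (γ : ℕ) (α : ℝ)
    (tie : TieRule M K) {t : ℕ} (h : History M K t) (m : Fin M) (f : Entry K → ℝ) :
    expect (playRound Q G γ α tie h m) f =
      expect (newCand G γ α h m) fun B => expect (firstArm (champions G γ α h m) B) fun i =>
        expect (secondArm tie m t (ucb G γ α h m) i) fun j =>
          expect (Q.duel i j) fun r => f (B, i, j, r) := by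
  simp only [playRound, expect_bind, expect_pure]

/-- A product of nonnegative factors, one for each player and round, whose conditional expectations
given the past are at most one, has expectation at most one. -/
theorem expect_law_prod_le_one [NeZero K] (Q : Instance K) (G : SimpleGraph (Fin M)) (γ : ℕ) (α : ℝ)
    (tie : TieRule M K) (g : ℕ → Fin M → Entry K → ℝ) (hg : ∀ s m e, 0 ≤ g s m e)
    (hle : ∀ (s : ℕ) (h : History M K s) (m : Fin M),
      expect (playRound Q G γ α tie h m) (g s m) ≤ 1) (T : ℕ) :
    expect (law Q G γ α tie T) (fun h => ∏ s : Fin T, ∏ m, g s m (h s m)) ≤ 1 := by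
  induction T with
  | zero => simp [law, expect_pure]
  | succ T ih =>
    rw [law, expect_bind]
    refine le_trans (expect_mono fun h => ?_) ih
    rw [expect_map]
    simp only [Fin.prod_univ_castSucc, Fin.snoc_castSucc, Fin.snoc_last, Fin.val_castSucc,
      Fin.val_last]
    rw [expect_const_mul, expect_indep_prod]
    refine mul_le_of_le_one_right (Finset.prod_nonneg fun s _ => Finset.prod_nonneg fun m _ =>
      hg _ _ _) (Finset.prod_le_one (fun m _ => ?_) fun m _ => hle T h m)
    exact Finset.sum_nonneg fun e _ => mul_nonneg ENNReal.toReal_nonneg (hg _ _ _)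

open Classical in
/-- The contribution of an entry to the exponential supermartingale of the duels between `i` and `j`:
each such duel contributes `l * (q i j - 1[i wins]) - l ^ 2 / 8` to the exponent. -/
noncomputable def expFactor (Q : Instance K) (i j : Fin K) (l : ℝ) (e : Entry K) : ℝ :=
  Real.exp (l * (Q.q i j * ((if e.Beats i j then 1 else 0) + (if e.Beats j i then 1 else 0)) -
    (if e.Beats i j then 1 else 0)) -
    l ^ 2 / 8 * ((if e.Beats i j then 1 else 0) + (if e.Beats j i then 1 else 0)))

theorem expect_duel_expFactor_le_one (Q : Instance K) {i j : Fin K} (hij : i ≠ j) (l : ℝ)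
    (B : Finset (Fin K)) (i' j' : Fin K) :
    expect (Q.duel i' j') (fun r => expFactor Q i j l (B, i', j', r)) ≤ 1 := by
  by_cases h1 : i' = i ∧ j' = j
  · obtain ⟨rfl, rfl⟩ := h1
    have h := bernoulli_exp_moment_le Q i' j' (-l)
    have : (fun r => expFactor Q i' j' l (B, i', j', r)) = fun r =>
        Real.exp (-(l ^ 2 / 8)) * Real.exp (-l * (if r then 1 else 0) - -l * Q.q i' j') := by
      ext r
      rw [← Real.exp_add]
      cases r <;> simp [expFactor, Entry.Beats, Entry.fst, Entry.snd, Entry.win, hij, hij.symm] <;>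
        ring
    rw [this, expect_const_mul]
    calc _ ≤ Real.exp (-(l ^ 2 / 8)) * Real.exp ((-l) ^ 2 / 8) := by gcongr
      _ = 1 := by rw [← Real.exp_add]; simp
  by_cases h2 : i' = j ∧ j' = i
  · obtain ⟨rfl, rfl⟩ := h2
    have h := bernoulli_exp_moment_le Q i' j' l
    have hq := Q.q_add_swap i' j'
    have : (fun r => expFactor Q j' i' l (B, i', j', r)) = fun r =>
        Real.exp (-(l ^ 2 / 8)) * Real.exp (l * (if r then 1 else 0) - l * Q.q i' j') := by
      ext r
      rw [← Real.exp_add, show Q.q i' j' = 1 - Q.q j' i' by linarith]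
      cases r <;> simp [expFactor, Entry.Beats, Entry.fst, Entry.snd, Entry.win, hij, hij.symm] <;>
        ring
    rw [this, expect_const_mul]
    calc _ ≤ Real.exp (-(l ^ 2 / 8)) * Real.exp (l ^ 2 / 8) := by gcongr
      _ = 1 := by rw [← Real.exp_add]; simp
  · have : (fun r => expFactor Q i j l (B, i', j', r)) = fun _ => 1 := by
      ext r
      have hb : ¬ Entry.Beats (B, i', j', r) i j := by
        simp only [Entry.Beats, Entry.fst, Entry.snd, Entry.win]; tauto
      have hb' : ¬ Entry.Beats (B, i', j', r) j i := by
        simp only [Entry.Beats, Entry.fst, Entry.snd, Entry.win]; tauto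
      simp [expFactor, hb, hb']
    rw [this, expect_const]

/-- The record of the first `t` rounds of a longer record. -/
def pre {T : ℕ} (h : History M K T) {t : ℕ} (ht : t ≤ T) : History M K t :=
  fun s => h (Fin.castLE ht s)

theorem sum_castLE {T t : ℕ} (ht : t ≤ T) (f : ℕ → Prop) [DecidablePred f] (g : Fin T → ℝ)
    (hf : ∀ s, f s → s < t) :
    ∑ s : Fin T, (if f s then g s else 0) =
      ∑ s : Fin t, (if f s then g (Fin.castLE ht s) else 0) := by
  symm
  rw [← Finset.sum_filter, ← Finset.sum_filter]
  refine Finset.sum_bij (fun s _ => Fin.castLE ht s) (fun s hs => ?_)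
    (fun s _ s' _ h => by simpa [Fin.ext_iff] using h) (fun s hs => ?_) (fun _ _ => rfl)
  · simpa using hs
  · have := (Finset.mem_filter.1 hs).2
    exact ⟨⟨s, hf _ this⟩, by simpa using this, rfl⟩

/-- The exponential supermartingale bound for the duels between `i` and `j` that are known to a
player at a fixed time. -/
theorem expect_exp_known_le_one [NeZero K] (Q : Instance K) (G : SimpleGraph (Fin M)) (γ : ℕ) (α : ℝ)
    (tie : TieRule M K) {T t : ℕ} (ht : t ≤ T) (m : Fin M) {i j : Fin K} (hij : i ≠ j) (l : ℝ) :
    expect (law Q G γ α tie T) (fun h => Real.exp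
      (l * (Q.q i j * knownDuels G γ (pre h ht) m i j - knownWins G γ (pre h ht) m i j) -
        l ^ 2 / 8 * knownDuels G γ (pre h ht) m i j)) ≤ 1 := by
  classical
  -- the set of messages received by `m` is deterministic
  let R : ℕ → Fin M → Prop := fun s m' => G.edist m m' ≤ γ ∧ s + 1 + delay G m m' ≤ t
  have hR : ∀ s m', R s m' → s < t := fun s m' h => by have := h.2; omega
  have key := expect_law_prod_le_one Q G γ α tie
    (fun s m' e => if R s m' then expFactor Q i j l e else 1)
    (fun s m' e => by
      split_ifs
      · exact (Real.exp_pos _).le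
      · norm_num)
    (fun s h m' => by
      by_cases hr : R s m'
      · simp only [hr, if_true]
        rw [expect_playRound, ← expect_const (newCand G γ α h m') 1]
        refine expect_mono fun B => ?_
        rw [← expect_const (firstArm (champions G γ α h m') B) 1]
        refine expect_mono fun i' => ?_
        rw [← expect_const (secondArm tie m' s (ucb G γ α h m') i') 1]
        exact expect_mono fun j' => expect_duel_expFactor_le_one Q hij l B i' j'
      · simp only [hr, if_false, expect_const, le_refl]) T
  refine le_trans (le_of_eq ?_) key
  congr 1
  ext h
  have hw : ∀ i j : Fin K, ((knownWins G γ (pre h ht) m i j : ℕ) : ℝ) =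
      ∑ s : Fin T, ∑ m', if R s m' then (if (h s m').Beats i j then (1 : ℝ) else 0) else 0 := by
    intro i j
    rw [knownWins, Finset.sum_comm (s := (Finset.univ : Finset (Fin T)))]
    push_cast
    refine Finset.sum_congr rfl fun m' _ => ?_
    have := sum_castLE ht (fun s => R s m') (fun s => if (h s m').Beats i j then (1 : ℝ) else 0)
      fun s => hR s m'
    refine Eq.trans (Finset.sum_congr rfl fun s _ => ?_) this.symm
    rw [← ite_and]
    congr
  have hd : ∀ s m', (if R s m' then (1 : ℝ) else 1) = 1 := by simp
  simp only [knownDuels, Nat.cast_add, hw i j, hw j i, ← Finset.sum_add_distrib, Finset.mul_sum,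
    ← Finset.sum_sub_distrib, Real.exp_sum]
  refine Finset.prod_congr rfl fun s _ => Finset.prod_congr rfl fun m' _ => ?_
  by_cases hr : R s m' <;> simp [hr, expFactor]

end Moment

/-! ### Concentration of the upper confidence terms -/

section Concentration

variable {M K : ℕ}

theorem Entry.not_beats_swap {e : Entry K} {i j : Fin K} (hij : i ≠ j) (h : e.Beats i j) :
    ¬ e.Beats j i := by
  rcases h with ⟨rfl, rfl, h⟩ | ⟨rfl, rfl, h⟩ <;> simp [Entry.Beats, hij, hij.symm, h]

open Classical in
theorem knownDuels_eq (G : SimpleGraph (Fin M)) (γ : ℕ) {t : ℕ} (h : History M K t) (m : Fin M)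
    {i j : Fin K} (hij : i ≠ j) :
    knownDuels G γ h m i j = ∑ m' : Fin M, ∑ s : Fin t,
      if Received G γ m m' s ∧ ((h s m').Beats i j ∨ (h s m').Beats j i) then 1 else 0 := by
  rw [knownDuels, knownWins, knownWins, ← Finset.sum_add_distrib]
  refine Finset.sum_congr rfl fun m' _ => ?_
  rw [← Finset.sum_add_distrib]
  refine Finset.sum_congr rfl fun s _ => ?_
  by_cases h1 : (h s m').Beats i j
  · simp [h1, Entry.not_beats_swap hij h1]
  · simp [h1]

theorem knownDuels_swap (G : SimpleGraph (Fin M)) (γ : ℕ) {t : ℕ} (h : History M K t) (m : Fin M)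
    (i j : Fin K) : knownDuels G γ h m i j = knownDuels G γ h m j i := by
  rw [knownDuels, knownDuels, add_comm]

theorem knownDuels_le (G : SimpleGraph (Fin M)) (γ : ℕ) {t : ℕ} (h : History M K t) (m : Fin M)
    {i j : Fin K} (hij : i ≠ j) :
    knownDuels G γ h m i j ≤ (maxDeg (powerGraph G γ) + 1) * t := by
  classical
  have hcard : (Finset.univ.filter fun m' => G.edist m m' ≤ γ).card ≤
      maxDeg (powerGraph G γ) + 1 := by
    have hsub : (Finset.univ.filter fun m' => G.edist m m' ≤ γ) ⊆
        insert m ((powerGraph G γ).neighborFinset m) := by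
      intro m' hm'
      rw [Finset.mem_filter] at hm'
      by_cases hmm : m = m'
      · simp [hmm]
      · refine Finset.mem_insert_of_mem ?_
        rw [SimpleGraph.mem_neighborFinset]
        exact ⟨hmm, hm'.2⟩
    refine (Finset.card_le_card hsub).trans ((Finset.card_insert_le _ _).trans ?_)
    rw [SimpleGraph.card_neighborFinset_eq_degree]
    have h1 := (powerGraph G γ).degree_le_maxDegree m
    refine Nat.add_le_add_right (le_trans (le_of_eq ?_) (h1.trans (le_of_eq ?_))) 1
    · congr
    · rw [maxDeg]
  rw [knownDuels_eq G γ h m hij]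
  calc _ ≤ ∑ m' : Fin M, if G.edist m m' ≤ γ then t else 0 := by
        refine Finset.sum_le_sum fun m' _ => ?_
        split_ifs with he
        · refine (Finset.sum_le_card_nsmul _ _ 1 fun s _ => by split_ifs <;> simp).trans ?_
          simp
        · refine le_of_eq (Finset.sum_eq_zero fun s _ => if_neg fun hs => he hs.1.1)
    _ = (Finset.univ.filter fun m' => G.edist m m' ≤ γ).card * t := by
        rw [← Finset.sum_filter, Finset.sum_const, smul_eq_mul]
    _ ≤ _ := Nat.mul_le_mul_right _ hcard

theorem ucb_of_pos (G : SimpleGraph (Fin M)) (γ : ℕ) (α : ℝ) {t : ℕ} (h : History M K t)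
    (m : Fin M) {i j : Fin K} (hij : i ≠ j) (hN : 0 < knownDuels G γ h m i j) :
    ucb G γ α h m i j = (knownWins G γ h m i j : ℝ) / knownDuels G γ h m i j +
      √(α * Real.log ((t : ℝ) + 1) / knownDuels G γ h m i j) := by
  have : (knownDuels G γ h m i j : ℝ) ≠ 0 := by exact_mod_cast hN.ne'
  simp [ucb, hij, div1, this]

/-- Without a known duel the confidence term equals `2`, by the convention `x / 0 = 1`. -/
theorem knownDuels_pos_of_ucb_lt (Q : Instance K) (G : SimpleGraph (Fin M)) (γ : ℕ) (α : ℝ) {t : ℕ}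
    (h : History M K t) (m : Fin M) {i j : Fin K} (hij : i ≠ j)
    (hlt : ucb G γ α h m i j < Q.q i j) : 0 < knownDuels G γ h m i j := by
  by_contra h0
  have h0 : knownDuels G γ h m i j = 0 := by omega
  have hq := Q.q_le_one i j
  simp only [ucb, hij, if_false, div1, h0, Nat.cast_zero, if_true, Real.sqrt_one] at hlt
  linarith

/-- As long as there are few duels, the confidence width alone is at least one. -/
theorem lt_knownDuels_of_ucb_lt (Q : Instance K) (G : SimpleGraph (Fin M)) (γ : ℕ) (α : ℝ) {t : ℕ}
    (h : History M K t) (m : Fin M) {i j : Fin K} (hij : i ≠ j)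
    (hlt : ucb G γ α h m i j < Q.q i j) :
    α * Real.log ((t : ℝ) + 1) < knownDuels G γ h m i j := by
  have hN := knownDuels_pos_of_ucb_lt Q G γ α h m hij hlt
  rw [ucb_of_pos G γ α h m hij hN] at hlt
  have hN' : (0 : ℝ) < knownDuels G γ h m i j := by exact_mod_cast hN
  by_contra hge
  have h1 : 1 ≤ √(α * Real.log ((t : ℝ) + 1) / knownDuels G γ h m i j) := by
    rw [Real.one_le_sqrt, le_div_iff₀ hN']; linarith
  have h2 : 0 ≤ (knownWins G γ h m i j : ℝ) / knownDuels G γ h m i j := by positivity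
  linarith [Q.q_le_one i j]

/-- The quadratic that governs a slice: `(r - 1) (z - r)` is nonnegative for `r` between `1` and `z`,
and it equals the slack of the exponent up to a factor. -/
theorem slice_exponent {x r z : ℝ} (hx : 0 ≤ x) (hr : 1 ≤ r) (hrz : r ≤ z) :
    x * (8 * z / (z + 1) ^ 2) ≤ 8 / (z + 1) * (x * r) - (8 / (z + 1)) ^ 2 / 8 * (x * r ^ 2) := by
  have hz : 0 < z + 1 := by linarith
  have h : 8 / (z + 1) * (x * r) - (8 / (z + 1)) ^ 2 / 8 * (x * r ^ 2) -
      x * (8 * z / (z + 1) ^ 2) = x * (8 / (z + 1) ^ 2) * ((r - 1) * (z - r)) := by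
    field_simp
    ring
  have : 0 ≤ x * (8 / (z + 1) ^ 2) * ((r - 1) * (z - r)) :=
    mul_nonneg (mul_nonneg hx (by positivity)) (mul_nonneg (by linarith) (by linarith))
  linarith

/-- The failure probability of a confidence term while the number of known duels lies in
`[a, z ^ 2 * a)`; the exponential moment is taken at the parameter that equalizes the exponents at
the two ends of the slice. -/
theorem prob_ucb_lt_slice [NeZero K] (Q : Instance K) (G : SimpleGraph (Fin M)) (γ : ℕ) {α : ℝ}
    (hα : 0 ≤ α) (tie : TieRule M K) {T t : ℕ} (ht : t ≤ T) (m : Fin M) {i j : Fin K} (hij : i ≠ j)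
    {a z : ℝ} (ha : 0 < a) (hz : 1 < z) :
    prob (law Q G γ α tie T) {h | ucb G γ α (pre h ht) m i j < Q.q i j ∧
      a ≤ knownDuels G γ (pre h ht) m i j ∧ knownDuels G γ (pre h ht) m i j ≤ z ^ 2 * a} ≤
      ((t : ℝ) + 1) ^ (-(α * (8 * z / (z + 1) ^ 2))) := by
  set x : ℝ := α * Real.log ((t : ℝ) + 1) with hx
  have hx0 : 0 ≤ x := mul_nonneg hα (Real.log_nonneg (by linarith [t.cast_nonneg (α := ℝ)]))
  set l : ℝ := 8 / (z + 1) * √(x / a) with hl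
  have hl0 : 0 ≤ l := mul_nonneg (by positivity) (Real.sqrt_nonneg _)
  set c : ℝ := Real.exp (-(x * (8 * z / (z + 1) ^ 2))) with hc
  have hcval : ((t : ℝ) + 1) ^ (-(α * (8 * z / (z + 1) ^ 2))) = c := by
    rw [Real.rpow_def_of_pos (by positivity), hc, hx]
    congr 1
    ring
  rw [hcval]
  have hE := expect_exp_known_le_one Q G γ α tie ht m hij l
  have hle := prob_le_expect (p := law Q G γ α tie T)
    (A := {h | ucb G γ α (pre h ht) m i j < Q.q i j ∧
      a ≤ knownDuels G γ (pre h ht) m i j ∧ knownDuels G γ (pre h ht) m i j ≤ z ^ 2 * a})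
    (f := fun h => c * Real.exp
      (l * (Q.q i j * knownDuels G γ (pre h ht) m i j - knownWins G γ (pre h ht) m i j) -
        l ^ 2 / 8 * knownDuels G γ (pre h ht) m i j))
    (fun h => by positivity) (fun h hh => by
      obtain ⟨h1, h2, h3⟩ := hh
      have hN := knownDuels_pos_of_ucb_lt Q G γ α _ m hij h1
      rw [ucb_of_pos G γ α _ m hij hN] at h1
      have hN' : (0 : ℝ) < knownDuels G γ (pre h ht) m i j := by exact_mod_cast hN
      set N : ℝ := (knownDuels G γ (pre h ht) m i j : ℝ)
      set w : ℝ := (knownWins G γ (pre h ht) m i j : ℝ)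
      set r : ℝ := √(N / a) with hr
      have hr2 : r ^ 2 = N / a := Real.sq_sqrt (by positivity)
      have hr1 : 1 ≤ r := by
        rw [hr, Real.one_le_sqrt, le_div_iff₀ ha]; linarith
      have hrz : r ≤ z := by
        rw [hr, Real.sqrt_le_left (by linarith), div_le_iff₀ ha]; exact h3
      have hdev : √(x / N) * N ≤ Q.q i j * N - w := by
        have h4 : (w / N + √(x / N)) * N ≤ Q.q i j * N :=
          mul_le_mul_of_nonneg_right h1.le hN'.le
        rw [add_mul, div_mul_cancel₀ _ hN'.ne'] at h4
        linarith
      have hprod : √(x / a) * (√(x / N) * N) = x * r := by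
        have : √(x / N) * N = √(x * N) := by
          conv_lhs => rw [← Real.sqrt_sq hN'.le]
          rw [Real.sqrt_sq hN'.le, Real.sqrt_div hx0, Real.sqrt_mul hx0, div_mul_eq_mul_div,
            mul_div_assoc, Real.div_sqrt]
        rw [this, hr, Real.sqrt_div hx0, Real.sqrt_div hN'.le, Real.sqrt_mul hx0,
          div_mul_eq_mul_div, ← mul_assoc, Real.mul_self_sqrt hx0, mul_div_assoc]
      have hlsq : l ^ 2 / 8 * N = (8 / (z + 1)) ^ 2 / 8 * (x * r ^ 2) := by
        rw [hl, mul_pow, Real.sq_sqrt (by positivity), hr2]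
        ring
      have hlin : 8 / (z + 1) * (x * r) ≤ l * (Q.q i j * N - w) := by
        rw [← hprod, hl, mul_assoc]
        gcongr
      have := slice_exponent hx0 hr1 hrz
      rw [hc, ← Real.exp_add]
      refine Real.one_le_exp ?_
      rw [hlsq]
      linarith)
  rw [expect_const_mul] at hle
  exact hle.trans (mul_le_of_le_one_right (Real.exp_pos _).le hE)

/-- The failure probability of a confidence term at a fixed time, by a union over geometric slices
of the number of known duels. -/
theorem prob_ucb_lt [NeZero K] (Q : Instance K) (G : SimpleGraph (Fin M)) (γ : ℕ) {α : ℝ}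
    (hα : 0 ≤ α) (tie : TieRule M K) {T t : ℕ} (ht : t ≤ T) (m : Fin M) {i j : Fin K} (hij : i ≠ j)
    {z : ℝ} (hz : 1 < z) :
    prob (law Q G γ α tie T) {h | ucb G γ α (pre h ht) m i j < Q.q i j} ≤
      (Real.log (((maxDeg (powerGraph G γ) : ℝ) + 1) * ((t : ℝ) + 1)) / Real.log (z ^ 2) + 1) *
      ((t : ℝ) + 1) ^ (-(α * (8 * z / (z + 1) ^ 2))) := by
  set P : ℝ := ((maxDeg (powerGraph G γ) : ℝ) + 1) * ((t : ℝ) + 1) with hP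
  have hP1 : 1 ≤ P := by
    have h1 := (maxDeg (powerGraph G γ)).cast_nonneg (α := ℝ)
    have h2 := t.cast_nonneg (α := ℝ)
    nlinarith
  have hy : 1 < z ^ 2 := by nlinarith
  have hlog : 0 < Real.log (z ^ 2) := Real.log_pos hy
  have hsum := prob_le_sum (p := law Q G γ α tie T)
    (A := {h | ucb G γ α (pre h ht) m i j < Q.q i j})
    (Finset.range (⌊Real.log P / Real.log (z ^ 2)⌋₊ + 1))
    (fun k => {h | ucb G γ α (pre h ht) m i j < Q.q i j ∧
      (z ^ 2) ^ k ≤ knownDuels G γ (pre h ht) m i j ∧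
        knownDuels G γ (pre h ht) m i j ≤ z ^ 2 * (z ^ 2) ^ k})
    (fun h hh => by
      have hN := knownDuels_pos_of_ucb_lt Q G γ α _ m hij hh
      have hNP : (knownDuels G γ (pre h ht) m i j : ℝ) ≤ P := by
        have h1 : ((knownDuels G γ (pre h ht) m i j : ℕ) : ℝ) ≤
          (((maxDeg (powerGraph G γ) + 1) * t : ℕ) : ℝ) :=
            Nat.cast_le.2 (knownDuels_le G γ (pre h ht) m hij)
        push_cast at h1
        refine h1.trans ?_
        rw [hP]
        gcongr
        linarith
      have hN1 : (1 : ℝ) ≤ knownDuels G γ (pre h ht) m i j := by exact_mod_cast hN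
      set N : ℝ := (knownDuels G γ (pre h ht) m i j : ℝ)
      obtain ⟨k, hk1, hk2⟩ := exists_nat_pow_near hN1 hy
      refine ⟨k, ?_, hh, hk1, ?_⟩
      · rw [Finset.mem_range, Nat.lt_succ_iff]
        refine Nat.le_floor ?_
        rw [le_div_iff₀ hlog, ← Real.log_pow]
        exact Real.log_le_log (by positivity) (hk1.trans hNP)
      · rw [pow_succ'] at hk2; exact hk2.le)
  refine hsum.trans ((Finset.sum_le_sum fun k _ =>
    prob_ucb_lt_slice Q G γ hα tie ht m hij (by positivity) hz).trans ?_)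
  rw [Finset.sum_const, Finset.card_range, nsmul_eq_mul]
  refine mul_le_mul_of_nonneg_right ?_ (by positivity)
  push_cast
  linarith [Nat.floor_le (div_nonneg (Real.log_nonneg hP1) hlog.le)]

theorem prob_ucb_lt_eq_zero [NeZero K] (Q : Instance K) (G : SimpleGraph (Fin M)) (γ : ℕ) {α : ℝ}
    (tie : TieRule M K) {T t : ℕ} (ht : t ≤ T) (m : Fin M) {i j : Fin K} (hij : i ≠ j)
    (hfew : ((maxDeg (powerGraph G γ) : ℝ) + 1) * ((t : ℝ) + 1) ≤ α * Real.log ((t : ℝ) + 1)) :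
    prob (law Q G γ α tie T) {h | ucb G γ α (pre h ht) m i j < Q.q i j} = 0 := by
  have : {h : History M K T | ucb G γ α (pre h ht) m i j < Q.q i j} = ∅ := by
    refine Set.eq_empty_of_forall_notMem fun h hh => ?_
    have h1 := lt_knownDuels_of_ucb_lt Q G γ α _ m hij hh
    have h2 : ((knownDuels G γ (pre h ht) m i j : ℕ) : ℝ) ≤
      (((maxDeg (powerGraph G γ) + 1) * t : ℕ) : ℝ) :=
        Nat.cast_le.2 (knownDuels_le G γ (pre h ht) m hij)
    push_cast at h2
    have h3 := (maxDeg (powerGraph G γ)).cast_nonneg (α := ℝ)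
    nlinarith
  rw [this]
  simp [prob]

end Concentration

/-! ### The draws of a player whose confidence terms are correct -/

namespace Instance

variable {K : ℕ} (Q : Instance K)

theorem gap_cw : Q.gap Q.cw = 0 := by simp [gap, Q.q_self]

theorem gap_pos {j : Fin K} (hj : j ≠ Q.cw) : 0 < Q.gap j := sub_pos.2 (Q.cw_wins j hj)

theorem gap_nonneg (j : Fin K) : 0 ≤ Q.gap j := by
  by_cases hj : j = Q.cw
  · rw [hj, gap_cw]
  · exact (Q.gap_pos hj).le

theorem gap_le_gapMax (j : Fin K) : Q.gap j ≤ Q.gapMax :=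
  Finset.le_sup' (f := Q.gap) (Finset.mem_univ j)

theorem gapMax_nonneg : 0 ≤ Q.gapMax := (Q.gap_nonneg Q.cw).trans (Q.gap_le_gapMax _)

theorem pairGap_pos {i j : Fin K} (hij : i ≠ j) : 0 < Q.pairGap i j := by
  unfold pairGap
  split_ifs with h1 h2
  · exact Q.gap_pos fun h => hij (h1.trans h.symm)
  · exact Q.gap_pos h1
  · exact lt_min (Q.gap_pos h1) (Q.gap_pos h2)

theorem pairGap_swap (i j : Fin K) : Q.pairGap i j = Q.pairGap j i := by
  unfold pairGap
  split_ifs with h1 h2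
  · rw [h1, h2]
  · rfl
  · rfl
  · rw [min_comm]

theorem pairGap_cw_left (j : Fin K) : Q.pairGap Q.cw j = Q.gap j := by simp [pairGap]

theorem pairGap_le_left {i : Fin K} (j : Fin K) (hi : i ≠ Q.cw) : Q.pairGap i j ≤ Q.gap i := by
  rw [pairGap, if_neg hi]
  split_ifs
  · exact le_rfl
  · exact min_le_left _ _

end Instance

section Draws

variable {M K : ℕ}

theorem delay_lt_max {G : SimpleGraph (Fin M)} {γ : ℕ} {m m' : Fin M} (h : G.edist m m' ≤ γ) :
    delay G m m' + 1 ≤ max γ 1 := by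
  have : G.dist m m' ≤ γ := by
    rw [SimpleGraph.dist]
    exact ENat.toNat_le_of_le_natCast h
  rw [delay]
  omega

/-- All confidence terms of the player `m` for pairs of distinct arms, computed from the record `h`
of the past rounds, bound the winning probabilities from above. -/
def Correct (Q : Instance K) (G : SimpleGraph (Fin M)) (γ : ℕ) (α : ℝ) {t : ℕ}
    (h : History M K t) (m : Fin M) : Prop :=
  ∀ i j, i ≠ j → Q.q i j ≤ ucb G γ α h m i j

theorem Correct.cw_mem {Q : Instance K} {G : SimpleGraph (Fin M)} {γ : ℕ} {α : ℝ} {t : ℕ}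
    {h : History M K t} {m : Fin M} (hc : Correct Q G γ α h m) :
    Q.cw ∈ champions G γ α h m := by
  simp only [champions, Finset.mem_filter, Finset.mem_univ, true_and]
  intro j
  by_cases hj : j = Q.cw
  · simp [ucb, hj]
  · exact (Q.cw_wins j hj).le.trans (hc _ _ (Ne.symm hj))

theorem secondArm_maximal {tie : TieRule M K} (htie : tie.Valid) {m : Fin M} {t : ℕ}
    {u : Fin K → Fin K → ℝ} {i j : Fin K} (hj : j ∈ (secondArm tie m t u i).support) (k : Fin K) :
    u k i ≤ u j i := by
  classical
  have hmem : j ∈ maximizers u i := by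
    simp only [secondArm] at hj
    split_ifs at hj with h1
    · exact Finset.mem_of_mem_erase (htie _ _ _ h1 _ hj)
    · rw [PMF.mem_support_pure_iff] at hj
      obtain ⟨l, -, hl⟩ := Finset.exists_max_image Finset.univ (fun k => u k i) ⟨i, by simp⟩
      have hl' : l ∈ maximizers u i := by simpa [maximizers] using fun k => hl k (Finset.mem_univ k)
      by_cases hli : l = i
      · rw [hj.trans hli.symm]; exact hl'
      · exact absurd ⟨l, Finset.mem_erase.2 ⟨hli, hl'⟩⟩ h1
  simp only [maximizers, Finset.mem_filter, Finset.mem_univ, true_and] at hmem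
  exact hmem k

variable [NeZero K]

theorem mem_of_mem_support_pick {S : Finset (Fin K)} (hS : S.Nonempty) {i : Fin K}
    (hi : i ∈ (pick S).support) : i ∈ S := by
  rw [pick, dif_pos hS] at hi
  simpa using hi

theorem mem_support_playRound {Q : Instance K} {G : SimpleGraph (Fin M)} {γ : ℕ} {α : ℝ}
    {tie : TieRule M K} {t : ℕ} {h : History M K t} {m : Fin M} {e : Entry K}
    (he : e ∈ (playRound Q G γ α tie h m).support) :
    e.cand ∈ (newCand G γ α h m).support ∧
      e.fst ∈ (firstArm (champions G γ α h m) e.cand).support ∧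
      e.snd ∈ (secondArm tie m t (ucb G γ α h m) e.fst).support := by
  simp only [playRound, PMF.mem_support_bind_iff, PMF.mem_support_pure_iff] at he
  obtain ⟨B, hB, i, hi, j, hj, r, -, rfl⟩ := he
  exact ⟨hB, hi, hj⟩

theorem subset_of_mem_support_newCand {G : SimpleGraph (Fin M)} {γ : ℕ} {α : ℝ} {t : ℕ}
    {h : History M K t} {m : Fin M} {B : Finset (Fin K)}
    (hB : B ∈ (newCand G γ α h m).support) : B ⊆ champions G γ α h m := by
  simp only [newCand] at hB
  split_ifs at hB with h1 h2
  · obtain ⟨i, hi, rfl⟩ := (PMF.mem_support_map_iff _ _ _).1 hB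
    exact Finset.singleton_subset_iff.2 (Finset.mem_inter.1 (mem_of_mem_support_pick h1 hi)).2
  · rw [PMF.mem_support_pure_iff] at hB
    exact hB.le
  · rw [PMF.mem_support_pure_iff] at hB
    exact hB ▸ Finset.inter_subset_right

/-- If every received recommendation that is a champion is the arm `b`, and `b` is recommended or was
the candidate before, then `b` is the candidate afterwards. -/
theorem eq_singleton_of_mem_support_newCand {G : SimpleGraph (Fin M)} {γ : ℕ} {α : ℝ} {t : ℕ}
    {h : History M K t} {m : Fin M} {B : Finset (Fin K)} {b : Fin K}
    (hB : B ∈ (newCand G γ α h m).support) (hb : b ∈ champions G γ α h m)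
    (hrec : ∀ i ∈ recommended G γ h m, i = b)
    (hor : b ∈ recommended G γ h m ∨ lastCand h m = {b}) : B = {b} := by
  simp only [newCand] at hB
  split_ifs at hB with h1 h2
  · obtain ⟨i, hi, rfl⟩ := (PMF.mem_support_map_iff _ _ _).1 hB
    rw [hrec i (Finset.mem_inter.1 (mem_of_mem_support_pick h1 hi)).1]
  · rw [PMF.mem_support_pure_iff] at hB
    obtain ⟨a, ha⟩ := Finset.card_eq_one.1 h2
    rw [hB, ha]
    rw [ha, Finset.mem_singleton] at hb
    rw [hb]
  · rw [PMF.mem_support_pure_iff] at hB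
    rcases hor with hor | hor
    · exact absurd ⟨b, Finset.mem_inter.2 ⟨hor, hb⟩⟩ h1
    · rw [hB, hor, Finset.singleton_inter_of_mem hb]

theorem mem_of_mem_support_firstArm {C B : Finset (Fin K)} (hC : C.Nonempty) (hBC : B ⊆ C)
    {i : Fin K} (hi : i ∈ (firstArm C B).support) : i ∈ C := by
  simp only [firstArm] at hi
  split_ifs at hi with h1 h2
  · exact absurd h1 hC.ne_empty
  · exact hBC (mem_of_mem_support_pick (h2.mono Finset.inter_subset_left) hi)
  · exact mem_of_mem_support_pick hC hi

theorem eq_of_mem_support_firstArm_singleton {C : Finset (Fin K)} {b : Fin K} (hb : b ∈ C)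
    {i : Fin K} (hi : i ∈ (firstArm C {b}).support) : i = b := by
  simp only [firstArm] at hi
  split_ifs at hi with h1 h2
  · simp [h1] at hb
  · simpa using mem_of_mem_support_pick (by simp) hi
  · exact absurd ⟨b, by simp [hb]⟩ h2

variable {Q : Instance K} {G : SimpleGraph (Fin M)} {γ : ℕ} {α : ℝ} {tie : TieRule M K} {t : ℕ}
  {h : History M K t} {m : Fin M} {e : Entry K}

theorem Correct.fst_mem (hc : Correct Q G γ α h m)
    (he : e ∈ (playRound Q G γ α tie h m).support) : e.fst ∈ champions G γ α h m :=
  have h3 := mem_support_playRound he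
  mem_of_mem_support_firstArm ⟨_, hc.cw_mem⟩ (subset_of_mem_support_newCand h3.1) h3.2.1

theorem Correct.fst_eq_of_cand (hc : Correct Q G γ α h m)
    (he : e ∈ (playRound Q G γ α tie h m).support) (hcand : e.cand = {Q.cw}) : e.fst = Q.cw := by
  have h3 := (mem_support_playRound he).2.1
  rw [hcand] at h3
  exact eq_of_mem_support_firstArm_singleton hc.cw_mem h3

/-- Only the Condorcet winner is drawn against itself: against any other arm the Condorcet winner has
a confidence term above `1 / 2`. -/
theorem Correct.fst_eq_of_fst_eq_snd (hc : Correct Q G γ α h m) (htie : tie.Valid)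
    (he : e ∈ (playRound Q G γ α tie h m).support) (heq : e.fst = e.snd) : e.fst = Q.cw := by
  by_contra hne
  have h1 := secondArm_maximal htie (mem_support_playRound he).2.2 Q.cw
  have h2 := hc Q.cw e.fst (Ne.symm hne)
  have h3 := Q.cw_wins _ hne
  rw [← heq] at h1
  simp only [ucb, if_true] at h1 h2
  linarith

/-- A pair of distinct arms is drawn only while its confidence width is at least half the effective
gap, that is, while few of its duels are known. -/
theorem Correct.knownDuels_le (hc : Correct Q G γ α h m) (htie : tie.Valid) (hα : 0 ≤ α)
    (he : e ∈ (playRound Q G γ α tie h m).support) (hne : e.fst ≠ e.snd) :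
    (knownDuels G γ h m e.fst e.snd : ℝ) ≤
      4 * α / Q.pairGap e.fst e.snd ^ 2 * Real.log ((t : ℝ) + 1) := by
  have hgap := Q.pairGap_pos hne
  have hlog : 0 ≤ Real.log ((t : ℝ) + 1) := Real.log_nonneg (by linarith [t.cast_nonneg (α := ℝ)])
  rcases Nat.eq_zero_or_pos (knownDuels G γ h m e.fst e.snd) with hN | hN
  · rw [hN, Nat.cast_zero]; positivity
  have hN' : (0 : ℝ) < knownDuels G γ h m e.fst e.snd := by exact_mod_cast hN
  have hmax := secondArm_maximal htie (mem_support_playRound he).2.2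
  have hmem := hc.fst_mem he
  simp only [champions, Finset.mem_filter, Finset.mem_univ, true_and] at hmem
  have hsum : 1 + Q.pairGap e.fst e.snd ≤
      ucb G γ α h m e.fst e.snd + ucb G γ α h m e.snd e.fst := by
    by_cases hi : e.fst = Q.cw
    · have h1 := hc _ _ hne
      have h2 := hmax e.fst
      rw [show ucb G γ α h m e.fst e.fst = 1 / 2 by simp [ucb]] at h2
      have h3 : Q.pairGap e.fst e.snd = Q.q e.fst e.snd - 1 / 2 := by
        rw [hi, Q.pairGap_cw_left]; rfl
      linarith
    · have h1 := hmem e.snd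
      have h2 := hmax Q.cw
      have h3 := hc Q.cw e.fst (Ne.symm hi)
      have h4 := Q.pairGap_le_left e.snd hi
      rw [Instance.gap] at h4
      linarith
  rw [ucb_of_pos G γ α h m hne hN, ucb_of_pos G γ α h m hne.symm (knownDuels_swap G γ h m _ _ ▸ hN),
    knownDuels_swap G γ h m e.snd e.fst] at hsum
  have hone : (knownWins G γ h m e.fst e.snd : ℝ) / knownDuels G γ h m e.fst e.snd +
      (knownWins G γ h m e.snd e.fst : ℝ) / knownDuels G γ h m e.fst e.snd = 1 := by
    rw [← add_div, ← Nat.cast_add]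
    exact div_self hN'.ne'
  have hsq : Q.pairGap e.fst e.snd / 2 ≤
      √(α * Real.log ((t : ℝ) + 1) / knownDuels G γ h m e.fst e.snd) := by linarith
  rw [Real.le_sqrt' (by positivity), le_div_iff₀ hN'] at hsq
  rw [div_mul_eq_mul_div, le_div_iff₀ (by positivity)]
  linarith

/-- Every round of a record in the support of the law is in the support of the round given the
past. -/
theorem mem_support_round {T : ℕ} {h : History M K T}
    (hh : h ∈ (law Q G γ α tie T).support) (t : Fin T) (m : Fin M) :
    h t m ∈ (playRound Q G γ α tie (pre h t.isLt.le) m).support := by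
  induction T with
  | zero => exact t.elim0
  | succ T ih =>
    simp only [law, PMF.mem_support_bind_iff, PMF.mem_support_map_iff] at hh
    obtain ⟨h', hh', e, he, rfl⟩ := hh
    refine Fin.lastCases ?_ (fun s => ?_) t
    · rw [Fin.snoc_last]
      have : pre (Fin.snoc h' e : History M K (T + 1)) (Fin.last T).isLt.le = h' := by
        funext s
        exact Fin.snoc_castSucc (α := fun _ => Fin M → Entry K) e h' s
      rw [this]
      exact mem_support_of_mem_support_indep he m
    · rw [Fin.snoc_castSucc]
      have : pre (Fin.snoc h' e : History M K (T + 1)) s.castSucc.isLt.le = pre h' s.isLt.le := by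
        funext r
        exact Fin.snoc_castSucc (α := fun _ => Fin M → Entry K) e h' (Fin.castLE s.isLt.le r)
      rw [this]
      exact ih hh' s

end Draws

/-! ### Counting the duels of a clique -/

section Counting

variable {M K : ℕ}

theorem edist_le_of_isClique {G : SimpleGraph (Fin M)} {γ : ℕ} {S : Finset (Fin M)}
    (hS : (powerGraph G γ).IsClique (S : Set (Fin M))) {m m' : Fin M} (hm : m ∈ S) (hm' : m' ∈ S) :
    G.edist m m' ≤ γ := by
  by_cases h : m = m'
  · simp [h]
  · exact (hS hm hm' h).2

/-- If each draw of a set of duels between `i` and `j` by the members of a clique was made while the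
player knew at most `b` such duels, then there are at most `b` draws, up to those that were still
under way when the last of them was made. -/
theorem card_duels_le {G : SimpleGraph (Fin M)} {γ γ' T : ℕ} (hγ : γ' ≤ γ) (h : History M K T)
    {S : Finset (Fin M)} (hS : (powerGraph G γ').IsClique (S : Set (Fin M))) {i j : Fin K}
    (hij : i ≠ j) {b : ℝ} (hb : 0 ≤ b) (E : Finset (Fin T × Fin M))
    (hE : ∀ p ∈ E, p.2 ∈ S ∧ ((h p.1 p.2).Beats i j ∨ (h p.1 p.2).Beats j i) ∧
      (knownDuels G γ (pre h p.1.isLt.le) p.2 i j : ℝ) ≤ b) :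
    (E.card : ℝ) ≤ b + S.card * (max γ' 1 : ℕ) := by
  classical
  rcases E.eq_empty_or_nonempty with rfl | hne
  · simp; positivity
  -- the player of the last draw knew all draws made at least `max γ' 1` rounds earlier
  obtain ⟨p, hp, hmax⟩ := E.exists_max_image (fun p => p.1) hne
  set g := max γ' 1 with hg
  have h1 : (E.filter fun q => (q.1 : ℕ) + g ≤ p.1).card ≤
      knownDuels G γ (pre h p.1.isLt.le) p.2 i j := by
    rw [knownDuels_eq G γ _ _ hij, ← Finset.sum_product', ← Finset.card_filter]
    refine (Finset.card_le_card fun q hq => ?_).trans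
      (Finset.card_image_le (f := fun r => (Fin.castLE p.1.isLt.le r.2, r.1)))
    obtain ⟨hqE, hqp⟩ := Finset.mem_filter.1 hq
    obtain ⟨hqS, hbeats, -⟩ := hE q hqE
    have hed := edist_le_of_isClique hS (hE p hp).1 hqS
    have hdel := delay_lt_max hed
    refine Finset.mem_image.2 ⟨(q.2, ⟨q.1, by omega⟩), ?_, rfl⟩
    refine Finset.mem_filter.2 ⟨by simp, ⟨hed.trans (by exact_mod_cast hγ), ?_⟩, hbeats⟩
    simp only
    omega
  have h2 : (E.filter fun q => ¬ (q.1 : ℕ) + g ≤ p.1).card ≤ S.card * g := by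
    have : (E.filter fun q => ¬ (q.1 : ℕ) + g ≤ p.1).card ≤
        (S ×ˢ Finset.Ico ((p.1 : ℕ) + 1 - g) (p.1 + 1)).card := by
      refine Finset.card_le_card_of_injOn (fun q => (q.2, (q.1 : ℕ))) (fun q hq => ?_)
        (fun q _ q' _ hqq => ?_)
      · have hq := Finset.mem_filter.1 (Finset.mem_coe.1 hq)
        have hle : (q.1 : ℕ) ≤ p.1 := hmax q hq.1
        simp only [Finset.coe_product, Set.mem_prod, Finset.mem_coe, Finset.mem_Ico]
        exact ⟨(hE q hq.1).1, by omega, by omega⟩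
      · simp only [Prod.mk.injEq] at hqq
        exact Prod.ext (Fin.ext hqq.2) hqq.1
    refine this.trans ?_
    rw [Finset.card_product, Nat.card_Ico]
    exact Nat.mul_le_mul_left _ (by omega)
  have h3 := Finset.card_filter_add_card_filter_not (s := E) (fun q => (q.1 : ℕ) + g ≤ p.1)
  have h4 : (E.card : ℝ) ≤ (knownDuels G γ (pre h p.1.isLt.le) p.2 i j : ℝ) + (S.card * g : ℕ) := by
    rw [← h3]; push_cast
    have h1' : ((E.filter fun q => (q.1 : ℕ) + g ≤ p.1).card : ℝ) ≤ _ := Nat.cast_le.2 h1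
    have h2' : ((E.filter fun q => ¬ (q.1 : ℕ) + g ≤ p.1).card : ℝ) ≤ _ := Nat.cast_le.2 h2
    push_cast at h2'
    linarith
  have := (hE p hp).2.2
  push_cast at h4
  linarith

theorem two_mul_card_pairs_le (K : ℕ) :
    2 * ∑ i : Fin K, (Finset.univ.filter fun j => i < j).card ≤ K ^ 2 := by
  have h1 : ∑ i : Fin K, (Finset.univ.filter fun j => i < j).card =
      ∑ i : Fin K, (Finset.univ.filter fun j => j < i).card := by
    simp only [Finset.card_filter]
    exact Finset.sum_comm
  rw [two_mul]
  nth_rewrite 2 [h1]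
  rw [← Finset.sum_add_distrib]
  calc _ ≤ ∑ i : Fin K, K := Finset.sum_le_sum fun i _ => by
        rw [← Finset.card_union_of_disjoint (Finset.disjoint_left.2 fun j hj hj' => by
          simp only [Finset.mem_filter] at hj hj'; exact lt_asymm hj.2 hj'.2)]
        exact (Finset.card_le_univ _).trans (by simp)
    _ = _ := by simp [sq]

end Counting

/-! ### How long a player waits for the Condorcet winner -/

/-- A quantity bounded by an affine function of its own logarithm. -/
theorem le_of_le_add_mul_log {x a b : ℝ} (hx : 0 < x) (hb : 0 < b) (h : x ≤ a + b * Real.log x) :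
    x ≤ 2 * a + 2 * b * Real.log (2 * b) - 2 * b := by
  have h1 := Real.log_le_sub_one_of_pos (show 0 < x / (2 * b) by positivity)
  rw [Real.log_div hx.ne' (by positivity)] at h1
  have h2 : b * (Real.log x - Real.log (2 * b)) ≤ b * (x / (2 * b) - 1) :=
    mul_le_mul_of_nonneg_left h1 hb.le
  have h3 : b * (x / (2 * b) - 1) = x / 2 - b := by field_simp
  linarith

section Settling

variable {M K : ℕ} [NeZero K] {Q : Instance K} {G : SimpleGraph (Fin M)} {γ : ℕ} {α : ℝ}
  {tie : TieRule M K} {T : ℕ} {h : History M K T} {c : ℝ}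

/-- In every round later than `c` all confidence terms of all players are correct; the index `t` stands
for round `t + 1`. -/
def CorrectAfter (Q : Instance K) (G : SimpleGraph (Fin M)) (γ : ℕ) (α : ℝ) {T : ℕ}
    (h : History M K T) (c : ℝ) : Prop :=
  ∀ t : Fin T, c < (t : ℕ) + 1 → ∀ m, Correct Q G γ α (pre h t.isLt.le) m

theorem eq_cw_of_mem_recommended (hh : h ∈ (law Q G γ α tie T).support) (htie : tie.Valid)
    (hc : CorrectAfter Q G γ α h c) {t : Fin T} (ht : c + γ < (t : ℕ)) {m : Fin M} {i : Fin K}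
    (hi : i ∈ recommended G γ (pre h t.isLt.le) m) : i = Q.cw := by
  simp only [recommended, Finset.mem_filter, Finset.mem_univ, true_and] at hi
  obtain ⟨m', s, ⟨hed, hs⟩, h1, h2⟩ := hi
  have hdel := delay_lt_max hed
  have hst : (t : ℕ) ≤ s + 1 + γ := by omega
  have hst' : ((t : ℕ) : ℝ) ≤ (s : ℕ) + 1 + γ := by exact_mod_cast hst
  have hcor := hc (Fin.castLE t.isLt.le s) (by simp only [Fin.val_castLE]; linarith) m'
  have hsup := mem_support_round hh (Fin.castLE t.isLt.le s) m'
  rw [← h1]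
  exact hcor.fst_eq_of_fst_eq_snd htie hsup (h1.trans h2.symm)

theorem cand_eq_of_heard (hh : h ∈ (law Q G γ α tie T).support) (htie : tie.Valid)
    (hc : CorrectAfter Q G γ α h c) {t : Fin T} (ht : c + γ < (t : ℕ)) {m : Fin M}
    (hor : Q.cw ∈ recommended G γ (pre h t.isLt.le) m ∨
      lastCand (pre h t.isLt.le) m = {Q.cw}) : (h t m).cand = {Q.cw} := by
  have hγ' := γ.cast_nonneg (α := ℝ)
  exact eq_singleton_of_mem_support_newCand (mem_support_playRound (mem_support_round hh t m)).1
    (hc t (by linarith) m).cw_mem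
    (fun i hi => eq_cw_of_mem_recommended hh htie hc ht hi) hor

theorem cand_eq_of_cand_eq_earlier (hh : h ∈ (law Q G γ α tie T).support) (htie : tie.Valid)
    (hc : CorrectAfter Q G γ α h c) {s t : ℕ} (hst : s ≤ t) (ht : t < T)
    (hs : c + γ < s) {m : Fin M} (hcand : (h ⟨s, hst.trans_lt ht⟩ m).cand = {Q.cw}) :
    (h ⟨t, ht⟩ m).cand = {Q.cw} := by
  induction t, hst using Nat.le_induction with
  | base => exact hcand
  | succ t hst ih =>
    have hst' : (s : ℝ) ≤ t := by exact_mod_cast hst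
    exact cand_eq_of_heard hh htie hc (t := ⟨t + 1, ht⟩) (by push_cast; linarith)
      (Or.inr (ih (by omega) hcand))

/-- As long as the candidate set of a player is not the Condorcet winner alone, no player nearby can
have drawn an arm against itself, except in the last rounds, whose messages are still under way. -/
theorem fst_ne_snd_of_cand_ne (hh : h ∈ (law Q G γ α tie T).support) (htie : tie.Valid)
    (hc : CorrectAfter Q G γ α h c) {γ' : ℕ} (hγ : γ' ≤ γ) {s t : Fin T} {m m' : Fin M}
    (hmm : G.edist m m' ≤ γ') (hs : c + γ < (s : ℕ)) (hst : (s : ℕ) + max γ' 1 ≤ t)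
    (hcand : (h t m).cand ≠ {Q.cw}) : (h s m').fst ≠ (h s m').snd := by
  intro heq
  have hγr := γ.cast_nonneg (α := ℝ)
  have hcw := (hc s (by linarith) m').fst_eq_of_fst_eq_snd htie (mem_support_round hh s m') heq
  have hdel := delay_lt_max hmm
  have hlt : (s : ℕ) + 1 + delay G m m' < T := by have := t.isLt; omega
  have hslt : ((s : ℕ) : ℝ) ≤ ((s : ℕ) + 1 + delay G m m' : ℕ) := by
    exact_mod_cast (by omega : (s : ℕ) ≤ (s : ℕ) + 1 + delay G m m')
  refine hcand (cand_eq_of_cand_eq_earlier hh htie hc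
    (s := (s : ℕ) + 1 + delay G m m') (by omega) t.isLt (by linarith) ?_)
  refine cand_eq_of_heard hh htie hc (t := ⟨_, hlt⟩) (by linarith) (Or.inl ?_)
  simp only [recommended, Finset.mem_filter, Finset.mem_univ, true_and]
  exact ⟨m', ⟨s, by omega⟩, ⟨hmm.trans (by exact_mod_cast hγ), rfl⟩, hcw,
    heq ▸ hcw⟩

/-- While a player waits, all members of a clique around it duel distinct arms, and there are only
logarithmically many such duels. -/
theorem card_mul_rounds_le (hh : h ∈ (law Q G γ α tie T).support) (htie : tie.Valid) (hα : 0 ≤ α)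
    (hc0 : 0 ≤ c) (hc : CorrectAfter Q G γ α h c) {γ' : ℕ} (hγ : γ' ≤ γ) {t : Fin T} {m : Fin M}
    {S : Finset (Fin M)} (hmS : m ∈ S) (hS : (powerGraph G γ').IsClique (S : Set (Fin M)))
    (hcand : (h t m).cand ≠ {Q.cw}) :
    (S.card : ℝ) * ((t : ℕ) - (max γ' 1 : ℕ) - (c + γ)) ≤
      Q.pairSum α * Real.log (t : ℕ) + S.card * (max γ' 1 : ℕ) * ((K : ℝ) ^ 2 / 2) := by
  classical
  set g := max γ' 1 with hg
  have hγr := γ.cast_nonneg (α := ℝ)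
  let A : Finset (Fin T) := Finset.univ.filter fun s => c + γ < (s : ℕ) ∧ (s : ℕ) + g ≤ t
  have hA : ((t : ℕ) : ℝ) - g - (c + γ) ≤ A.card := by
    have h1 : (Finset.Ioc ⌊c + γ⌋₊ ((t : ℕ) - g)).card ≤ A.card := by
      refine (Finset.card_le_card fun n hn => ?_).trans
        (Finset.card_image_le (s := A) (f := fun s => (s : ℕ)))
      rw [Finset.mem_Ioc] at hn
      have := t.isLt
      refine Finset.mem_image.2 ⟨⟨n, by omega⟩, ?_, rfl⟩
      simp only [A, Finset.mem_filter, Finset.mem_univ, true_and]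
      exact ⟨(Nat.floor_lt (by positivity)).1 hn.1, by omega⟩
    have h2 : (t : ℕ) ≤ A.card + g + ⌊c + γ⌋₊ := by
      rw [Nat.card_Ioc] at h1; omega
    have h2' : ((t : ℕ) : ℝ) ≤ A.card + g + ⌊c + γ⌋₊ := by exact_mod_cast h2
    linarith [Nat.floor_le (show 0 ≤ c + γ by positivity)]
  let E : Fin K → Fin K → Finset (Fin T × Fin M) := fun i j => (A ×ˢ S).filter fun p =>
    (h p.1 p.2).Beats i j ∨ (h p.1 p.2).Beats j i
  have hE : ∀ i j, i ≠ j → ((E i j).card : ℝ) ≤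
      4 * α / Q.pairGap i j ^ 2 * Real.log (t : ℕ) + S.card * g := by
    intro i j hij
    refine card_duels_le hγ h hS hij (mul_nonneg (by positivity) (Real.log_natCast_nonneg _)) (E i j)
      fun p hp => ?_
    simp only [E, A, Finset.mem_filter, Finset.mem_product, Finset.mem_univ, true_and] at hp
    obtain ⟨⟨⟨hp1, hp2⟩, hpS⟩, hbeats⟩ := hp
    refine ⟨hpS, hbeats, ?_⟩
    have hne := fst_ne_snd_of_cand_ne hh htie hc hγ (edist_le_of_isClique hS hmS hpS) hp1 hp2
      hcand
    have hk := (hc p.1 (by linarith) p.2).knownDuels_le htie hα (mem_support_round hh p.1 p.2) hne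
    have hlog : Real.log (((p.1 : ℕ) : ℝ) + 1) ≤ Real.log (t : ℕ) :=
      Real.log_le_log (by positivity) (by exact_mod_cast (by omega : (p.1 : ℕ) + 1 ≤ t))
    have hk' : (knownDuels G γ (pre h p.1.isLt.le) p.2 i j : ℝ) ≤
        4 * α / Q.pairGap i j ^ 2 * Real.log (((p.1 : ℕ) : ℝ) + 1) := by
      rcases hbeats with (⟨h1, h2, -⟩ | ⟨h1, h2, -⟩) | (⟨h1, h2, -⟩ | ⟨h1, h2, -⟩)
      · rwa [h1, h2] at hk
      · rwa [h1, h2, knownDuels_swap, Q.pairGap_swap] at hk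
      · rwa [h1, h2, knownDuels_swap, Q.pairGap_swap] at hk
      · rwa [h1, h2] at hk
    exact hk'.trans (by gcongr)
  have hcover : A ×ˢ S ⊆ Finset.univ.biUnion fun i : Fin K =>
      (Finset.univ.filter fun j => i < j).biUnion fun j => E i j := by
    intro p hp
    have hp' := hp
    simp only [A, Finset.mem_filter, Finset.mem_product, Finset.mem_univ, true_and] at hp
    obtain ⟨⟨hp1, hp2⟩, hpS⟩ := hp
    have hne := fst_ne_snd_of_cand_ne hh htie hc hγ (edist_le_of_isClique hS hmS hpS) hp1 hp2
      hcand
    simp only [Finset.mem_biUnion, Finset.mem_filter, Finset.mem_univ, true_and, E]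
    rcases lt_or_gt_of_ne hne with hlt | hlt
    · refine ⟨_, _, hlt, hp', ?_⟩
      cases hw : (h p.1 p.2).win <;> simp [Entry.Beats, hw]
    · refine ⟨_, _, hlt, hp', ?_⟩
      cases hw : (h p.1 p.2).win <;> simp [Entry.Beats, hw]
  have hcard : ((A ×ˢ S).card : ℝ) ≤ ∑ i : Fin K, ∑ j ∈ Finset.univ.filter (fun j => i < j),
      (4 * α / Q.pairGap i j ^ 2 * Real.log (t : ℕ) + S.card * g) := by
    have h1 : (A ×ˢ S).card ≤ ∑ i : Fin K, ∑ j ∈ Finset.univ.filter (fun j => i < j),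
        (E i j).card := (Finset.card_le_card hcover).trans (Finset.card_biUnion_le.trans
      (Finset.sum_le_sum fun i _ => Finset.card_biUnion_le))
    have h2 : ((A ×ˢ S).card : ℝ) ≤ _ := Nat.cast_le.2 h1
    refine h2.trans ?_
    push_cast
    exact Finset.sum_le_sum fun i _ => Finset.sum_le_sum fun j hj =>
      hE i j (Finset.mem_filter.1 hj).2.ne
  have hP : ((∑ i : Fin K, (Finset.univ.filter fun j => i < j).card : ℕ) : ℝ) ≤
      (K : ℝ) ^ 2 / 2 := by
    have : ((2 * ∑ i : Fin K, (Finset.univ.filter fun j => i < j).card : ℕ) : ℝ) ≤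
      ((K ^ 2 : ℕ) : ℝ) := Nat.cast_le.2 (two_mul_card_pairs_le K)
    push_cast at this ⊢
    linarith
  simp only [Finset.sum_add_distrib, ← Finset.sum_mul, Finset.sum_const, nsmul_eq_mul] at hcard
  rw [Finset.card_product] at hcard
  push_cast at hcard hP
  rw [Instance.pairSum]
  have h1 : (S.card : ℝ) * ((t : ℕ) - g - (c + γ)) ≤ S.card * A.card := by gcongr
  have h2 := mul_le_mul_of_nonneg_left hP (show 0 ≤ (S.card : ℝ) * g by positivity)
  linarith

end Settling

/-! ### The pathwise regret bound -/

section Regret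

variable {M K : ℕ}

theorem exists_maxClique {V : Type} [Fintype V] (G : SimpleGraph V) (v : V) :
    ∃ S : Finset V, v ∈ S ∧ G.IsClique (S : Set V) ∧ S.card = maxCliqueAt G v := by
  classical
  obtain ⟨S, hS, hcard⟩ := Finset.exists_mem_eq_sup
    (Finset.univ.filter (fun s : Finset V => v ∈ s ∧ G.IsClique (s : Set V))) ⟨{v}, by simp⟩
    Finset.card
  rw [Finset.mem_filter] at hS
  refine ⟨S, hS.2.1, hS.2.2, ?_⟩
  rw [maxCliqueAt, ← hcard]

theorem one_le_maxCliqueAt {V : Type} [Fintype V] (G : SimpleGraph V) (v : V) :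
    1 ≤ maxCliqueAt G v := by
  obtain ⟨S, hv, -, hcard⟩ := exists_maxClique G v
  rw [← hcard]
  exact Finset.card_pos.2 ⟨v, hv⟩

theorem exists_cliqueCover {V : Type} [Fintype V] (G : SimpleGraph V) :
    ∃ 𝒮 : Finset (Finset V), 𝒮.card = cliqueCoverNumber G ∧
      (∀ s ∈ 𝒮, G.IsClique (s : Set V)) ∧ ∀ v, ∃ s ∈ 𝒮, v ∈ s := by
  classical
  refine Nat.sInf_mem (s := {n | ∃ 𝒮 : Finset (Finset V), 𝒮.card = n ∧
    (∀ s ∈ 𝒮, G.IsClique (s : Set V)) ∧ ∀ v, ∃ s ∈ 𝒮, v ∈ s})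
    ⟨_, Finset.univ.image fun v => {v}, rfl, fun s hs => ?_, fun v => ⟨{v}, ?_, by simp⟩⟩
  · obtain ⟨v, -, rfl⟩ := Finset.mem_image.1 hs
    simp
  · exact Finset.mem_image_of_mem _ (Finset.mem_univ v)

/-- Summed over the players, the duels that are drawn while few of them are known are bounded through
a clique cover, whose cliques are first made disjoint. -/
theorem card_duels_le_cliqueCover {G : SimpleGraph (Fin M)} {γ T : ℕ} (h : History M K T)
    {i j : Fin K} (hij : i ≠ j) {b : ℝ} (hb : 0 ≤ b) (E : Finset (Fin T × Fin M))
    (hE : ∀ p ∈ E, ((h p.1 p.2).Beats i j ∨ (h p.1 p.2).Beats j i) ∧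
      (knownDuels G γ (pre h p.1.isLt.le) p.2 i j : ℝ) ≤ b) :
    (E.card : ℝ) ≤ cliqueCoverNumber (powerGraph G γ) * b + M * (max γ 1 : ℕ) := by
  classical
  obtain ⟨𝒮, hcard, hcl, hcov⟩ := exists_cliqueCover (powerGraph G γ)
  choose f hf hmf using hcov
  let P : Finset (Fin M) → Finset (Fin M) := fun S => Finset.univ.filter fun m => f m = S
  have hP : ∀ S ∈ 𝒮, ((E.filter fun p => f p.2 = S).card : ℝ) ≤
      b + (P S).card * (max γ 1 : ℕ) := fun S hS => by
    refine card_duels_le (G := G) le_rfl h (fun m hm m' hm' hne => ?_) hij hb _ fun p hp => ?_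
    · simp only [P, Finset.coe_filter, Finset.mem_univ, true_and, Set.mem_ofPred_eq] at hm hm'
      exact hcl S hS (by simpa using hm ▸ hmf m) (by simpa using hm' ▸ hmf m') hne
    · obtain ⟨h1, h2⟩ := Finset.mem_filter.1 hp
      exact ⟨by simp [P, h2], hE p h1⟩
  have hsum : ∑ S ∈ 𝒮, (P S).card = M := by
    rw [← Finset.card_eq_sum_card_fiberwise (fun m _ => hf m), Finset.card_univ, Fintype.card_fin]
  have hEsum : E.card = ∑ S ∈ 𝒮, (E.filter fun p => f p.2 = S).card :=
    Finset.card_eq_sum_card_fiberwise fun p _ => hf p.2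
  rw [hEsum, ← hcard, Nat.cast_sum]
  refine (Finset.sum_le_sum hP).trans (le_of_eq ?_)
  rw [Finset.sum_add_distrib, Finset.sum_const, nsmul_eq_mul, ← Finset.sum_mul]
  congr 2
  exact_mod_cast hsum

variable {Q : Instance K} {G : SimpleGraph (Fin M)} {γ : ℕ} {α : ℝ}
  {tie : TieRule M K} {T : ℕ} {h : History M K T} {c : ℝ}

theorem pairSum_pos (hK : 2 ≤ K) (hα : 0 < α) : 0 < Q.pairSum α := by
  have hterm : ∀ i j : Fin K, 0 ≤ 4 * α / Q.pairGap i j ^ 2 := fun i j => by positivity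
  have h01 : (⟨0, by omega⟩ : Fin K) < ⟨1, by omega⟩ := Fin.mk_lt_mk.2 Nat.zero_lt_one
  have hpos : 0 < 4 * α / Q.pairGap (⟨0, by omega⟩ : Fin K) ⟨1, by omega⟩ ^ 2 := by
    have := Q.pairGap_pos h01.ne
    positivity
  refine hpos.trans_le (le_trans ?_ (Finset.single_le_sum
    (fun i _ => Finset.sum_nonneg fun j _ => hterm i j) (Finset.mem_univ (⟨0, by omega⟩ : Fin K))))
  exact Finset.single_le_sum (f := fun j => 4 * α / Q.pairGap (⟨0, by omega⟩ : Fin K) j ^ 2)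
    (fun j _ => hterm _ j) (Finset.mem_filter.2 ⟨Finset.mem_univ _, h01⟩)

/-- The bound on the rounds in which the player `m` has not yet found the Condorcet winner, when
it relies on a clique of the `γ'`-power graph. -/
noncomputable def waitBound (Q : Instance K) (G : SimpleGraph (Fin M)) (γ : ℕ) (α c : ℝ)
    (m : Fin M) (γ' : ℕ) : ℝ :=
  2 * (c + γ + (max γ' 1 : ℕ) + (max γ' 1 : ℕ) * ((K : ℝ) ^ 2 / 2)) +
    2 * (Q.pairSum α / maxCliqueAt (powerGraph G γ') m) *
      Real.log (2 * (Q.pairSum α / maxCliqueAt (powerGraph G γ') m)) -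
    2 * (Q.pairSum α / maxCliqueAt (powerGraph G γ') m)

theorem le_waitBound (hK : 2 ≤ K) (hα : 0 < α) (hc : 0 ≤ c) (m : Fin M) (γ' : ℕ) :
    c + γ ≤ waitBound Q G γ α c m γ' := by
  have hb : 0 < Q.pairSum α / maxCliqueAt (powerGraph G γ') m :=
    div_pos (pairSum_pos hK hα) (by exact_mod_cast one_le_maxCliqueAt _ m)
  set y := 2 * (Q.pairSum α / maxCliqueAt (powerGraph G γ') m) with hy
  have hy0 : 0 < y := by positivity
  -- `y * log y - y ≥ -1`, so the bound is meaningful even if the logarithm is negative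
  have h1 := Real.one_sub_inv_le_log_of_pos hy0
  have h2 : y * (1 - y⁻¹) ≤ y * Real.log y := mul_le_mul_of_nonneg_left h1 hy0.le
  rw [mul_sub, mul_inv_cancel₀ hy0.ne'] at h2
  have h3 : (1 : ℝ) ≤ (max γ' 1 : ℕ) := by exact_mod_cast le_max_right _ _
  have h4 := γ.cast_nonneg (α := ℝ)
  have h5 : 0 ≤ ((max γ' 1 : ℕ) : ℝ) * ((K : ℝ) ^ 2 / 2) := by positivity
  rw [waitBound, ← hy]
  linarith

theorem card_early_le {X : ℝ} (hX : 0 ≤ X) (T : ℕ) :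
    ((Finset.univ.filter fun t : Fin T => ((t : ℕ) : ℝ) ≤ X).card : ℝ) ≤ X + 1 := by
  have h1 : (Finset.univ.filter fun t : Fin T => ((t : ℕ) : ℝ) ≤ X).card ≤
      (Finset.range (⌊X⌋₊ + 1)).card :=
    Finset.card_le_card_of_injOn (fun t => (t : ℕ)) (fun t ht => by
      have := (Finset.mem_filter.1 (Finset.mem_coe.1 ht)).2
      simpa [Nat.lt_succ_iff] using Nat.le_floor this) (fun t _ t' _ h => Fin.ext h)
  rw [Finset.card_range] at h1
  have h2 : ((Finset.univ.filter fun t : Fin T => ((t : ℕ) : ℝ) ≤ X).card : ℝ) ≤ _ := Nat.cast_le.2 h1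
  push_cast at h2
  linarith [Nat.floor_le hX]

/-- The waiting time and the delayed duels after it fit into the finite-time term. -/
theorem waitBound_add_le (hK : 2 ≤ K) (hα : 0 < α) (m : Fin M) {γ' : ℕ} (hγ : γ' ≤ γ) :
    waitBound Q G γ α c m γ' + 1 + (K : ℝ) / 2 * (max γ 1 : ℕ) ≤
      (K : ℝ) ^ 2 * ((γ' : ℝ) + 2) +
        2 * Q.pairSum α / (maxCliqueAt (powerGraph G γ') m : ℝ) *
          Real.log (2 * Q.pairSum α / (maxCliqueAt (powerGraph G γ') m : ℝ)) +
      (2 * c + (K : ℝ) * (3 * (γ : ℝ) + 2)) := by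
  have hb : 0 < Q.pairSum α / maxCliqueAt (powerGraph G γ') m :=
    div_pos (pairSum_pos hK hα) (by exact_mod_cast one_le_maxCliqueAt _ m)
  have h1 : ((max γ' 1 : ℕ) : ℝ) ≤ γ' + 1 := by exact_mod_cast (by omega : max γ' 1 ≤ γ' + 1)
  have h2 : ((max γ 1 : ℕ) : ℝ) ≤ γ + 1 := by exact_mod_cast (by omega : max γ 1 ≤ γ + 1)
  have h3 : (γ' : ℝ) ≤ γ := by exact_mod_cast hγ
  have h4 : (2 : ℝ) ≤ K := by exact_mod_cast hK
  have h5 := γ'.cast_nonneg (α := ℝ)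
  have h6 : ((max γ' 1 : ℕ) : ℝ) * (K : ℝ) ^ 2 ≤ (γ' + 1) * (K : ℝ) ^ 2 := by gcongr
  have h7 : (K : ℝ) / 2 * (max γ 1 : ℕ) ≤ (K : ℝ) / 2 * (γ + 1) := by gcongr
  have h8 : 2 * (γ : ℝ) ≤ K * γ := by gcongr
  have h9 : (K : ℝ) * 2 ≤ K ^ 2 := by rw [sq]; gcongr
  rw [waitBound, mul_div_assoc 2 (Q.pairSum α)]
  nlinarith

variable [NeZero K]

theorem round_le_waitBound (hh : h ∈ (law Q G γ α tie T).support) (htie : tie.Valid) (hK : 2 ≤ K)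
    (hα : 0 < α) (hc0 : 0 ≤ c) (hc : CorrectAfter Q G γ α h c) {γ' : ℕ} (hγ : γ' ≤ γ) {t : Fin T}
    {m : Fin M} (hcand : (h t m).cand ≠ {Q.cw}) :
    ((t : ℕ) : ℝ) ≤ waitBound Q G γ α c m γ' := by
  rcases Nat.eq_zero_or_pos (t : ℕ) with h0 | h0
  · have := le_waitBound (Q := Q) (G := G) (γ := γ) hK hα hc0 m γ'
    rw [h0, Nat.cast_zero]
    exact le_trans (by positivity) this
  obtain ⟨S, hmS, hS, hcard⟩ := exists_maxClique (powerGraph G γ') m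
  have hkey := card_mul_rounds_le hh htie hα.le hc0 hc hγ hmS hS hcand
  rw [hcard] at hkey
  have hΓ : (0 : ℝ) < maxCliqueAt (powerGraph G γ') m := by exact_mod_cast one_le_maxCliqueAt _ m
  refine le_of_le_add_mul_log (by exact_mod_cast h0) (div_pos (pairSum_pos hK hα) hΓ) ?_
  set Γ : ℝ := (maxCliqueAt (powerGraph G γ') m : ℝ)
  have h1 : ((t : ℕ) : ℝ) - (max γ' 1 : ℕ) - (c + γ) ≤
      (Q.pairSum α * Real.log (t : ℕ) + Γ * (max γ' 1 : ℕ) * ((K : ℝ) ^ 2 / 2)) / Γ := by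
    rw [le_div_iff₀ hΓ, mul_comm]
    exact hkey
  rw [add_div, mul_assoc Γ, mul_div_cancel_left₀ _ hΓ.ne', mul_div_right_comm] at h1
  linarith

/-- The regret of a record whose confidence terms are all correct after round `c`. -/
theorem regret_le (hh : h ∈ (law Q G γ α tie T).support) (htie : tie.Valid) (hK : 2 ≤ K)
    (hα : 0 < α) (hc0 : 0 ≤ c) (hc : CorrectAfter Q G γ α h c) :
    regret Q h ≤ leadTerm Q G γ α T + finiteTerm' Q G γ α c := by
  classical
  have hex : ∀ m : Fin M, ∃ γ' ∈ Finset.range (γ + 1),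
      ((Finset.range (γ + 1)).inf' ⟨0, by simp⟩ fun γ' : ℕ => (K : ℝ) ^ 2 * ((γ' : ℝ) + 2) +
        2 * Q.pairSum α / (maxCliqueAt (powerGraph G γ') m : ℝ) *
          Real.log (2 * Q.pairSum α / (maxCliqueAt (powerGraph G γ') m : ℝ))) =
      (K : ℝ) ^ 2 * ((γ' : ℝ) + 2) +
        2 * Q.pairSum α / (maxCliqueAt (powerGraph G γ') m : ℝ) *
          Real.log (2 * Q.pairSum α / (maxCliqueAt (powerGraph G γ') m : ℝ)) :=
    fun m => Finset.exists_mem_eq_inf' _ _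
  choose g hgmem hg using hex
  have hgγ : ∀ m, g m ≤ γ := fun m => Nat.lt_succ_iff.1 (Finset.mem_range.1 (hgmem m))
  have hγr := γ.cast_nonneg (α := ℝ)
  let X : Fin M → ℝ := fun m => waitBound Q G γ α c m (g m)
  have hcX : ∀ m, c + γ ≤ X m := fun m => le_waitBound hK hα hc0 m _
  let L : Fin K → Finset (Fin T × Fin M) := fun j =>
    Finset.univ.filter fun p => X p.2 < ((p.1 : ℕ) : ℝ) ∧ (h p.1 p.2).snd = j
  -- in the late rounds, those with index beyond `X m`, the first arm is the Condorcet winner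
  have hlate : ∀ (t : Fin T) (m : Fin M), X m < ((t : ℕ) : ℝ) →
      Correct Q G γ α (pre h t.isLt.le) m ∧ (h t m).fst = Q.cw := fun t m ht => by
    have hcor := hc t (by linarith [hcX m]) m
    refine ⟨hcor, hcor.fst_eq_of_cand (mem_support_round hh t m) ?_⟩
    by_contra hcand
    exact absurd (round_le_waitBound hh htie hK hα hc0 hc (hgγ m) hcand) (not_le.2 ht)
  have hround : ∀ (m : Fin M) (t : Fin T),
      (1 / 2) * (Q.gap (h t m).fst + Q.gap (h t m).snd) ≤
        (if ((t : ℕ) : ℝ) ≤ X m then Q.gapMax else 0) +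
          ∑ j ∈ Finset.univ.erase Q.cw, if (t, m) ∈ L j then Q.gap j / 2 else 0 := fun m t => by
    have hnn : 0 ≤ ∑ j ∈ Finset.univ.erase Q.cw, if (t, m) ∈ L j then Q.gap j / 2 else 0 :=
      Finset.sum_nonneg fun j _ => by
        split_ifs
        · linarith [Q.gap_nonneg j]
        · exact le_rfl
    split_ifs with ht
    · linarith [Q.gap_le_gapMax (h t m).fst, Q.gap_le_gapMax (h t m).snd]
    · rw [not_le] at ht
      rw [(hlate t m ht).2, Q.gap_cw]
      by_cases hs : (h t m).snd = Q.cw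
      · rw [hs, Q.gap_cw]; linarith
      · have := Finset.single_le_sum
          (f := fun j => if (t, m) ∈ L j then Q.gap j / 2 else 0) (fun j _ => by
            split_ifs
            · linarith [Q.gap_nonneg j]
            · exact le_rfl) (Finset.mem_erase.2 ⟨hs, Finset.mem_univ (h t m).snd⟩)
        have hmem : (t, m) ∈ L (h t m).snd := by simp [L, ht]
        rw [if_pos hmem] at this
        linarith
  have hL : ∀ j ∈ Finset.univ.erase Q.cw, ((L j).card : ℝ) * (Q.gap j / 2) ≤
      2 * α * (cliqueCoverNumber (powerGraph G γ) : ℝ) / Q.gap j * Real.log T +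
        M * (max γ 1 : ℕ) * (Q.gapMax / 2) := fun j hj => by
    have hj' := Finset.ne_of_mem_erase hj
    have hgap := Q.gap_pos hj'
    have hcard := card_duels_le_cliqueCover (G := G) (γ := γ) h (Ne.symm hj')
      (b := 4 * α / Q.gap j ^ 2 * Real.log T)
      (mul_nonneg (by positivity) (Real.log_natCast_nonneg _)) (L j) (fun p hp => by
        obtain ⟨h1, h2⟩ := (Finset.mem_filter.1 hp).2
        obtain ⟨hcor, hfst⟩ := hlate p.1 p.2 h1
        refine ⟨?_, ?_⟩
        · cases hw : (h p.1 p.2).win <;> simp [Entry.Beats, hw, hfst, h2]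
        · have hk := hcor.knownDuels_le htie hα.le (mem_support_round hh p.1 p.2)
            (by rw [hfst, h2]; exact Ne.symm hj')
          rw [hfst, h2, Q.pairGap_cw_left] at hk
          refine hk.trans ?_
          gcongr
          exact_mod_cast p.1.isLt)
    calc _ ≤ (cliqueCoverNumber (powerGraph G γ) * (4 * α / Q.gap j ^ 2 * Real.log T) +
          M * (max γ 1 : ℕ)) * (Q.gap j / 2) := by gcongr
      _ = 2 * α * (cliqueCoverNumber (powerGraph G γ) : ℝ) / Q.gap j * Real.log T +
          M * (max γ 1 : ℕ) * (Q.gap j / 2) := by field_simp; ring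
      _ ≤ _ := by gcongr; exact Q.gap_le_gapMax j
  have hsplit : regret Q h ≤ ∑ m, (X m + 1) * Q.gapMax +
      ∑ j ∈ Finset.univ.erase Q.cw, ((L j).card : ℝ) * (Q.gap j / 2) := by
    rw [regret]
    refine (Finset.sum_le_sum fun m _ => Finset.sum_le_sum fun t _ => hround m t).trans ?_
    simp only [Finset.sum_add_distrib]
    refine add_le_add (Finset.sum_le_sum fun m _ => ?_) (le_of_eq ?_)
    · rw [← Finset.sum_filter, Finset.sum_const, nsmul_eq_mul]
      exact mul_le_mul_of_nonneg_right (card_early_le ((by positivity : 0 ≤ c + γ).trans (hcX m)) T)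
        Q.gapMax_nonneg
    · rw [← Finset.sum_product', Finset.sum_comm]
      refine Finset.sum_congr rfl fun j _ => ?_
      rw [← Finset.sum_filter, Finset.sum_const, nsmul_eq_mul]
      congr 2
      exact Finset.card_bij (fun p _ => (p.2, p.1)) (fun p hp => by simpa using hp)
        (fun p _ p' _ hpp => by simpa [Prod.ext_iff, and_comm] using hpp)
        (fun p hp => ⟨(p.2, p.1), by simpa using hp, rfl⟩)
  have hcardK : (((Finset.univ.erase Q.cw).card : ℕ) : ℝ) ≤ K := by
    exact_mod_cast (Finset.card_le_univ _).trans (by simp)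
  have hsumL := Finset.sum_le_sum hL
  rw [Finset.sum_add_distrib, ← Finset.sum_mul, Finset.sum_const, nsmul_eq_mul] at hsumL
  have htail : ((Finset.univ.erase Q.cw).card : ℝ) * (M * (max γ 1 : ℕ) * (Q.gapMax / 2)) ≤
      ∑ _m : Fin M, (K : ℝ) / 2 * (max γ 1 : ℕ) * Q.gapMax := by
    rw [Finset.sum_const, nsmul_eq_mul, Finset.card_univ, Fintype.card_fin]
    have hg0 := Q.gapMax_nonneg
    calc _ ≤ (K : ℝ) * (M * (max γ 1 : ℕ) * (Q.gapMax / 2)) := by gcongr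
      _ = _ := by ring
  have hfin : ∑ m, (X m + 1) * Q.gapMax + ∑ _m : Fin M, (K : ℝ) / 2 * (max γ 1 : ℕ) * Q.gapMax ≤
      finiteTerm' Q G γ α c := by
    rw [← Finset.sum_add_distrib, finiteTerm']
    simp only [hg]
    have : (2 * c + (K : ℝ) * (3 * (γ : ℝ) + 2)) * (M : ℝ) * Q.gapMax =
        Q.gapMax * ∑ _m : Fin M, (2 * c + (K : ℝ) * (3 * (γ : ℝ) + 2)) := by
      rw [Finset.sum_const, nsmul_eq_mul, Finset.card_univ, Fintype.card_fin]; ring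
    rw [this, ← mul_add, ← Finset.sum_add_distrib, Finset.mul_sum]
    refine Finset.sum_le_sum fun m _ => ?_
    rw [← add_mul, mul_comm]
    exact mul_le_mul_of_nonneg_left (waitBound_add_le hK hα m (hgγ m)) Q.gapMax_nonneg
  rw [leadTerm]
  linarith

end Regret

/-! ### Tail sums and the Lambert threshold -/

section Analysis

/-- `(A + b * log u) * u ^ (-κ)`, the shape of the failure probability in round `u`. -/
noncomputable def tailTerm (A b κ u : ℝ) : ℝ := (A + b * Real.log u) * u ^ (-κ)

/-- The integral of `tailTerm A b κ` over `[u, ∞)`. -/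
noncomputable def tailIntegral (A b κ u : ℝ) : ℝ :=
  ((A + b * Real.log u) / (κ - 1) + b / (κ - 1) ^ 2) * u ^ (1 - κ)

theorem hasDerivAt_tailIntegral {A b κ u : ℝ} (hκ : 1 < κ) (hu : 0 < u) :
    HasDerivAt (tailIntegral A b κ) (-tailTerm A b κ u) u := by
  have h1 : HasDerivAt (fun u => (A + b * Real.log u) / (κ - 1) + b / (κ - 1) ^ 2)
      (b * u⁻¹ / (κ - 1)) u :=
    ((((Real.hasDerivAt_log hu.ne').const_mul b).const_add A).div_const _).add_const _
  have h2 : HasDerivAt (fun u : ℝ => u ^ (1 - κ)) ((1 - κ) * u ^ (1 - κ - 1)) u :=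
    Real.hasDerivAt_rpow_const (Or.inl hu.ne')
  refine (h1.mul h2).congr_deriv ?_
  have hκ' : κ - 1 ≠ 0 := by linarith
  rw [show 1 - κ - 1 = -κ by ring, show 1 - κ = -κ + 1 by ring, Real.rpow_add_one hu.ne', tailTerm]
  field_simp
  ring

theorem tailTerm_nonneg {A b κ u : ℝ} (hA : 0 ≤ A) (hb : 0 ≤ b) (hu : 1 ≤ u) :
    0 ≤ tailTerm A b κ u :=
  mul_nonneg (add_nonneg hA (mul_nonneg hb (Real.log_nonneg hu)))
    (Real.rpow_nonneg (by linarith) _)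

theorem tailTerm_le_tailTerm {A b κ u v : ℝ} (hA : 0 ≤ A) (hb : 0 ≤ b) (hκ : 1 < κ) (hu : 1 ≤ u)
    (huv : u ≤ v) (hlog : b ≤ κ * (b * Real.log u)) : tailTerm A b κ v ≤ tailTerm A b κ u := by
  have hu0 : 0 < u := by linarith
  have hv0 : 0 < v := by linarith
  set l := Real.log (v / u) with hl
  have hl0 : 0 ≤ l := Real.log_nonneg (by rw [le_div_iff₀ hu0]; linarith)
  have hlv : Real.log v = Real.log u + l := by rw [hl, Real.log_div hv0.ne' hu0.ne']; ring
  have hv : v ^ (-κ) = u ^ (-κ) * Real.exp (-(κ * l)) := by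
    rw [Real.rpow_def_of_pos hv0, Real.rpow_def_of_pos hu0, ← Real.exp_add, hlv]
    congr 1
    ring
  have hexp : 1 + κ * l ≤ Real.exp (κ * l) := by linarith [Real.add_one_le_exp (κ * l)]
  have hlu := Real.log_nonneg hu
  have hkey : A + b * Real.log v ≤ (A + b * Real.log u) * Real.exp (κ * l) := by
    have h1 : (A + b * Real.log u) * (1 + κ * l) ≤ (A + b * Real.log u) * Real.exp (κ * l) := by
      gcongr
    have h2 : b * l ≤ κ * (b * Real.log u) * l := mul_le_mul_of_nonneg_right hlog hl0
    have h3 : 0 ≤ A * (κ * l) := by positivity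
    rw [hlv]
    linarith
  rw [tailTerm, tailTerm, hv, Real.exp_neg]
  calc _ ≤ ((A + b * Real.log u) * Real.exp (κ * l)) * (u ^ (-κ) * (Real.exp (κ * l))⁻¹) := by
        gcongr
    _ = _ := by field_simp

theorem mul_tailTerm_le {A b κ u v : ℝ} (hA : 0 ≤ A) (hb : 0 ≤ b) (hκ : 1 < κ) (hu : 1 ≤ u)
    (huv : u ≤ v) (hlog : b ≤ κ * (b * Real.log u)) :
    (v - u) * tailTerm A b κ v ≤ tailIntegral A b κ u - tailIntegral A b κ v := by
  rcases huv.eq_or_lt with rfl | huv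
  · simp
  have hder : ∀ x ∈ Set.Icc u v, HasDerivAt (tailIntegral A b κ) (-tailTerm A b κ x) x :=
    fun x hx => hasDerivAt_tailIntegral hκ (by linarith [hx.1])
  obtain ⟨x, hx, hslope⟩ := exists_hasDerivAt_eq_slope (tailIntegral A b κ)
    (fun x => -tailTerm A b κ x) huv (fun x hx => (hder x hx).continuousAt.continuousWithinAt)
    fun x hx => hder x (Set.Ioo_subset_Icc_self hx)
  rw [eq_div_iff (by linarith)] at hslope
  have hlogx : b ≤ κ * (b * Real.log x) := hlog.trans (by gcongr; exact hx.1.le)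
  have h1 := tailTerm_le_tailTerm hA hb hκ (hu.trans hx.1.le) hx.2.le hlogx
  have h2 := mul_le_mul_of_nonneg_left h1 (sub_nonneg.2 huv.le)
  linarith

/-- The sum of a decreasing function over the integers beyond `s` is at most its first term and an
integral. -/
theorem sum_tailTerm_le {A b κ s : ℝ} (hA : 0 ≤ A) (hb : 0 ≤ b) (hκ : 1 < κ) (hs : 1 ≤ s)
    (hlog : b ≤ κ * (b * Real.log s)) (T : ℕ) :
    ∑ t : Fin T, (if s < (t : ℕ) + 1 then tailTerm A b κ ((t : ℕ) + 1) else 0) ≤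
      tailTerm A b κ s + tailIntegral A b κ s := by
  have hint : ∀ u, s ≤ u → 0 ≤ tailIntegral A b κ u := fun u hu => by
    have := Real.log_nonneg (hs.trans hu)
    have h1 : 0 < κ - 1 := by linarith
    have h2 : 0 < u := by linarith
    unfold tailIntegral
    positivity
  have hnn := tailTerm_nonneg (κ := κ) hA hb hs
  suffices h : ((T : ℝ) ≤ s → ∑ t : Fin T,
        (if s < (t : ℕ) + 1 then tailTerm A b κ ((t : ℕ) + 1) else 0) = 0) ∧
      (s < T → ∑ t : Fin T, (if s < (t : ℕ) + 1 then tailTerm A b κ ((t : ℕ) + 1) else 0) ≤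
        tailTerm A b κ s + tailIntegral A b κ s - tailIntegral A b κ T) by
    rcases le_or_gt (T : ℝ) s with hT | hT
    · rw [h.1 hT]; linarith [hint s le_rfl]
    · linarith [h.2 hT, hint T hT.le]
  induction T with
  | zero => exact ⟨fun _ => by simp, fun h => by simp at h; linarith⟩
  | succ T ih =>
    simp only [Fin.sum_univ_castSucc, Fin.val_castSucc, Fin.val_last]
    push_cast
    refine ⟨fun hT => ?_, fun hT => ?_⟩
    · rw [ih.1 (by linarith), if_neg (not_lt.2 hT), add_zero]
    · rw [if_pos hT]
      rcases le_or_gt (T : ℝ) s with hTs | hTs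
      · rw [ih.1 hTs, zero_add]
        have h1 := tailTerm_le_tailTerm hA hb hκ hs hT.le hlog
        have h2 := mul_tailTerm_le hA hb hκ hs hT.le hlog
        have h3 := mul_nonneg (sub_nonneg.2 hT.le)
          (tailTerm_nonneg (κ := κ) hA hb (hs.trans hT.le))
        linarith
      · have h1 := mul_tailTerm_le (v := T + 1) hA hb hκ (hs.trans hTs.le) (by linarith)
          (hlog.trans (by gcongr))
        have h2 := ih.2 hTs
        linarith

/-- The tail sum in the form of a power of `s`, when `s ≥ exp (1 / ε)` and `log s ≤ s ^ ε`. -/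
theorem tailTerm_add_tailIntegral_le {A b κ ε s : ℝ} (hA : 0 ≤ A) (hb : 0 ≤ b) (hε : 0 < ε)
    (hκ : 1 + ε < κ) (hs : Real.exp (1 / ε) ≤ s) (hlog : Real.log s ≤ s ^ ε) :
    tailTerm A b κ s + tailIntegral A b κ s ≤
      (2 * A / Real.exp 1 + 3 * b) / min 1 (κ - 1) * s ^ (-(κ - 1 - ε)) := by
  have hs1 : 1 ≤ s := le_trans (Real.one_le_exp (by positivity)) hs
  have hs0 : 0 < s := by linarith
  have hls : 1 / ε ≤ Real.log s := (Real.le_log_iff_exp_le hs0).2 hs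
  have hls0 : 0 ≤ Real.log s := Real.log_nonneg hs1
  have hκ1 : 0 < κ - 1 := by linarith
  set μ := min 1 (κ - 1) with hμ
  have hμ0 : 0 < μ := lt_min one_pos hκ1
  have hμ1 : 1 ≤ 1 / μ := by rw [le_div_iff₀ hμ0, one_mul]; exact min_le_left _ _
  have hμ2 : 1 / (κ - 1) ≤ 1 / μ := one_div_le_one_div_of_le hμ0 (min_le_right _ _)
  have hlog1 : 1 / (κ - 1) ≤ Real.log s := le_trans (one_div_le_one_div_of_le hε (by linarith)) hls
  have hpow : s ^ (1 - κ) = s ^ (-(κ - 1 - ε)) * s ^ (-ε) := by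
    rw [← Real.rpow_add hs0]; congr 1; ring
  have hexp : s ^ (-ε) ≤ 1 / Real.exp 1 := by
    rw [Real.rpow_neg hs0.le, ← one_div]
    refine one_div_le_one_div_of_le (Real.exp_pos 1) ?_
    rw [Real.rpow_def_of_pos hs0, Real.exp_le_exp]
    rwa [div_le_iff₀ hε] at hls
  have hlogpow : Real.log s * s ^ (-ε) ≤ 1 := by
    rw [Real.rpow_neg hs0.le, ← div_eq_mul_inv, div_le_one (Real.rpow_pos_of_pos hs0 _)]
    exact hlog
  have h1 : tailTerm A b κ s ≤ (A + b * Real.log s) * (1 / μ) * s ^ (1 - κ) := by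
    rw [tailTerm]
    calc _ ≤ (A + b * Real.log s) * s ^ (1 - κ) := by
          gcongr
          linarith
      _ ≤ _ := by
          gcongr
          exact le_mul_of_one_le_right (by positivity) hμ1
  have h2 : tailIntegral A b κ s ≤
      ((A + b * Real.log s) * (1 / μ) + b * Real.log s * (1 / μ)) * s ^ (1 - κ) := by
    rw [tailIntegral]
    have h3 : (A + b * Real.log s) / (κ - 1) ≤ (A + b * Real.log s) * (1 / μ) := by
      rw [div_eq_mul_one_div]; gcongr
    have h4 : b / (κ - 1) ^ 2 ≤ b * Real.log s * (1 / μ) := by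
      rw [show b / (κ - 1) ^ 2 = b * (1 / (κ - 1)) * (1 / (κ - 1)) by field_simp]
      gcongr
    gcongr
  calc _ ≤ ((A + b * Real.log s) * (1 / μ) +
        ((A + b * Real.log s) * (1 / μ) + b * Real.log s * (1 / μ))) * s ^ (1 - κ) := by linarith
    _ = (2 * A * s ^ (-ε) + 3 * b * (Real.log s * s ^ (-ε))) / μ * s ^ (-(κ - 1 - ε)) := by
      rw [hpow]; ring
    _ ≤ (2 * A * (1 / Real.exp 1) + 3 * b * 1) / μ * s ^ (-(κ - 1 - ε)) := by gcongr
    _ = _ := by ring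

theorem mul_exp_neg_antitone {u v : ℝ} (hu : 1 ≤ u) (huv : u ≤ v) :
    v * Real.exp (-v) ≤ u * Real.exp (-u) := by
  have h1 := Real.add_one_le_exp (v - u)
  have h2 : v ≤ u * Real.exp (v - u) := by nlinarith
  calc _ ≤ u * Real.exp (v - u) * Real.exp (-v) := by gcongr
    _ = _ := by rw [mul_assoc, ← Real.exp_add]; congr 2; ring

theorem mul_exp_neg_lt {v : ℝ} (hv : 0 < v) : v * Real.exp (-v) < 2 / v := by
  have h := Real.quadratic_le_exp_of_nonneg hv.le
  rw [Real.exp_neg, ← div_eq_mul_inv, div_lt_div_iff₀ (Real.exp_pos v) hv]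
  nlinarith

theorem lambertNeg_spec {ε : ℝ} (hε : 0 < ε) (hε1 : ε < Real.exp (-1)) :
    lambertNeg (-ε) ≤ -1 ∧ lambertNeg (-ε) * Real.exp (lambertNeg (-ε)) = -ε := by
  set W : Set ℝ := {w : ℝ | w ≤ -1 ∧ w * Real.exp w = -ε} with hW
  have hcont : Continuous fun w : ℝ => w * Real.exp w := by fun_prop
  have hclosed : IsClosed W :=
    isClosed_Iic.inter (isClosed_singleton.preimage hcont)
  have hε2 : ε < 1 := hε1.trans (Real.exp_lt_one_iff.2 (by norm_num))
  have hne : W.Nonempty := by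
    have h2 : -(2 / ε) ≤ -1 := by
      rw [neg_le_neg_iff, le_div_iff₀ hε]; linarith
    obtain ⟨w, hw, hwe⟩ := intermediate_value_Icc' h2 hcont.continuousOn
      (show -ε ∈ Set.Icc (-1 * Real.exp (-1)) (-(2 / ε) * Real.exp (-(2 / ε))) from
        ⟨by linarith, by
          have := mul_exp_neg_lt (show 0 < 2 / ε by positivity)
          rw [div_div_cancel₀ two_ne_zero] at this
          linarith⟩)
    exact ⟨w, hw.2, hwe⟩
  have hbdd : BddBelow W := by
    refine ⟨-(2 / ε), fun w hw => ?_⟩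
    have hw1 := hw.1
    have h := mul_exp_neg_lt (show 0 < -w by linarith)
    rw [neg_neg, neg_mul, hw.2, neg_neg, lt_div_iff₀ (by linarith)] at h
    rw [neg_le, le_div_iff₀ hε]
    linarith
  exact hclosed.csInf_mem hne hbdd

/-- From the Lambert threshold on, the logarithm is below the power. -/
theorem log_le_rpow_of_Teps_le {ε s : ℝ} (hε : 0 < ε) (hs : 1 ≤ s) (hT : Teps ε ≤ s) :
    Real.log s ≤ s ^ ε := by
  have hs0 : 0 < s := by linarith
  set v := Real.log s * ε with hv
  have hv0 : 0 ≤ v := mul_nonneg (Real.log_nonneg hs) hε.le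
  have hpow : s ^ ε = Real.exp v := Real.rpow_def_of_pos hs0 _
  suffices h : v * Real.exp (-v) ≤ ε by
    rw [Real.exp_neg, ← div_eq_mul_inv, div_le_iff₀ (Real.exp_pos v), hv, mul_comm ε] at h
    rw [hpow]
    exact le_of_mul_le_mul_right h hε
  by_cases hε1 : ε < Real.exp (-1)
  · obtain ⟨hw1, hw2⟩ := lambertNeg_spec hε hε1
    rw [Teps, if_pos hε1] at hT
    set w := -lambertNeg (-ε) with hw
    have hlw : lambertNeg (-ε) = -w := by rw [hw, neg_neg]
    rw [hlw] at hw1 hw2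
    have hw0 : 0 < w := by linarith
    have hwε : w * Real.exp (-w) = ε := by linarith
    have hexp : w / ε = Real.exp w := by
      rw [div_eq_iff hε.ne', ← hwε, mul_left_comm, ← Real.exp_add]; simp
    have h1 : Real.exp w ≤ Real.exp v := by
      rw [← hexp, ← hpow]
      calc w / ε = ((w / ε) ^ (1 / ε)) ^ ε := by
            rw [← Real.rpow_mul (by positivity), one_div_mul_cancel hε.ne', Real.rpow_one]
        _ ≤ s ^ ε := Real.rpow_le_rpow (by positivity) hT hε.le
    exact (mul_exp_neg_antitone (by linarith) (Real.exp_le_exp.1 h1)).trans hwε.le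
  · refine le_trans ?_ (not_lt.1 hε1)
    have h := Real.add_one_le_exp (v - 1)
    calc v * Real.exp (-v) ≤ Real.exp (v - 1) * Real.exp (-v) := by gcongr; linarith
      _ = _ := by rw [← Real.exp_add]; congr 1; ring

end Analysis

/-! ### The probability of late failures -/

section Failure

variable {M K : ℕ} {Q : Instance K} {G : SimpleGraph (Fin M)} {γ : ℕ} {α : ℝ}
  {tie : TieRule M K} {T : ℕ}

open Classical in
/-- The last round in which some confidence term of some player fails (zero if there is none). -/
noncomputable def lastFailure (Q : Instance K) (G : SimpleGraph (Fin M)) (γ : ℕ) (α : ℝ) {T : ℕ}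
    (h : History M K T) : ℕ :=
  (Finset.univ.filter fun t : Fin T => ∃ m, ¬ Correct Q G γ α (pre h t.isLt.le) m).sup
    fun t => (t : ℕ) + 1

theorem correctAfter_iff {h : History M K T} {c : ℝ} (hc : 0 ≤ c) :
    CorrectAfter Q G γ α h c ↔ (lastFailure Q G γ α h : ℝ) ≤ c := by
  classical
  rw [← Nat.le_floor_iff hc, lastFailure, Finset.sup_le_iff]
  simp only [CorrectAfter, Finset.mem_filter, Finset.mem_univ, true_and, Nat.le_floor_iff hc]
  push_cast
  constructor
  · rintro h t ⟨m, hm⟩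
    by_contra hlt
    exact hm (h t (not_le.1 hlt) m)
  · intro h t ht m
    by_contra hm
    exact absurd (h t ⟨m, hm⟩) (not_le.2 ht)

theorem lt_lastFailure_eq {c : ℝ} (hc : 0 ≤ c) :
    {h : History M K T | c < (lastFailure Q G γ α h : ℝ)} = {h | ¬ CorrectAfter Q G γ α h c} := by
  ext h
  simp only [Set.mem_ofPred_eq, correctAfter_iff hc, not_le]

variable [NeZero K]

theorem prob_not_correctAfter_le {c : ℝ} {r : ℝ → ℝ} (hr : ∀ t : Fin T, c < (t : ℕ) + 1 →
      0 ≤ r ((t : ℕ) + 1) ∧ ∀ m i j, i ≠ j → prob (law Q G γ α tie T)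
        {h | ucb G γ α (pre h t.isLt.le) m i j < Q.q i j} ≤ r ((t : ℕ) + 1)) :
    prob (law Q G γ α tie T) {h | ¬ CorrectAfter Q G γ α h c} ≤
      M * (K : ℝ) ^ 2 * ∑ t : Fin T, if c < (t : ℕ) + 1 then r ((t : ℕ) + 1) else 0 := by
  classical
  let s : Finset (Fin T × Fin M × Fin K × Fin K) :=
    (Finset.univ.filter fun t : Fin T => c < (t : ℕ) + 1) ×ˢ Finset.univ
  refine (prob_le_sum s (fun p => {h | p.2.2.1 ≠ p.2.2.2 ∧
    ucb G γ α (pre h p.1.isLt.le) p.2.1 p.2.2.1 p.2.2.2 < Q.q p.2.2.1 p.2.2.2})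
    fun h hh => ?_).trans ?_
  · simp only [CorrectAfter, Correct, Set.mem_ofPred_eq, not_forall, not_le] at hh
    obtain ⟨t, ht, m, i, j, hij, hlt⟩ := hh
    exact ⟨(t, m, i, j), by simp [s, ht], hij, hlt⟩
  · have hle : ∀ p ∈ s, prob (law Q G γ α tie T) {h | p.2.2.1 ≠ p.2.2.2 ∧
        ucb G γ α (pre h p.1.isLt.le) p.2.1 p.2.2.1 p.2.2.2 < Q.q p.2.2.1 p.2.2.2} ≤
          r ((p.1 : ℕ) + 1) := fun p hp => by
      have hp1 : c < (p.1 : ℕ) + 1 := by simpa [s] using hp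
      by_cases hij : p.2.2.1 = p.2.2.2
      · simpa [hij, prob] using (hr p.1 hp1).1
      · exact (prob_mono_of_support fun h _ hh => hh.2).trans ((hr p.1 hp1).2 _ _ _ hij)
    refine (Finset.sum_le_sum hle).trans (le_of_eq ?_)
    rw [Finset.sum_product, Finset.mul_sum, Finset.sum_filter]
    refine Finset.sum_congr rfl fun t _ => ?_
    split_ifs
    · refine (Finset.sum_const (r ((t : ℕ) + 1))).trans ?_
      rw [nsmul_eq_mul, Finset.card_univ]
      simp only [Fintype.card_prod, Fintype.card_fin]
      push_cast
      ring
    · simp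

theorem sizeTerm_pos {G : SimpleGraph (Fin M)} {γ : ℕ} (hM : 0 < M) : 0 < sizeTerm K G γ := by
  have hK : 0 < K := Nat.pos_of_ne_zero (NeZero.ne K)
  have : 0 ≤ Real.log ((maxDeg (powerGraph G γ) : ℝ) + 1) := Real.log_nonneg (by simp)
  unfold sizeTerm
  positivity

theorem one_le_maxDeg_add_one : (1 : ℝ) ≤ (maxDeg (powerGraph G γ) : ℝ) + 1 := by simp

theorem lt_exponent_of_lt {α η : ℝ} (hη : 1 < η) {x : ℝ} (hα : 0.5 * √η * x < α) :
    x < 2 * α * η ^ (-(1 / 2) : ℝ) := by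
  have hsq : 0 < √η := Real.sqrt_pos.2 (by linarith)
  rw [Real.rpow_neg (by linarith), ← Real.sqrt_eq_rpow, ← div_eq_mul_inv, lt_div_iff₀ hsq]
  linarith

/-- The tail bound for late failures behind `Ctilde`: slices of ratio `4` have the exponent
`16 α / 9 ≥ 1.7 α`, and the logarithmic number of slices is absorbed by a factor `t ^ 0.4`. -/
theorem prob_not_correctAfter_le_of_one_le (hα : 2.4 / 1.7 < α) {s : ℝ} (hs : 1 ≤ s) :
    prob (law Q G γ α tie T) {h | ¬ CorrectAfter Q G γ α h s} ≤
      4 * sizeTerm K G γ * s ^ (-(1.7 * α - 1.4)) := by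
  set l := Real.log ((maxDeg (powerGraph G γ) : ℝ) + 1) with hl
  have hl0 : 0 ≤ l := Real.log_nonneg one_le_maxDeg_add_one
  have hα' : 2.4 < 1.7 * α := by rw [div_lt_iff₀ (by norm_num)] at hα; linarith
  set v := 1.7 * α - 0.4 with hv
  have hv1 : 2 < v := by rw [hv]; linarith
  have hbound : ∀ t : Fin T, s < (t : ℕ) + 1 → 0 ≤ tailTerm (l + 3.5) 0 v ((t : ℕ) + 1) ∧
      ∀ m i j, i ≠ j → prob (law Q G γ α tie T)
        {h | ucb G γ α (pre h t.isLt.le) m i j < Q.q i j} ≤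
          tailTerm (l + 3.5) 0 v ((t : ℕ) + 1) := by
    intro t ht
    set τ : ℝ := ((t : ℕ) : ℝ) + 1 with hτ
    have hτ1 : 1 ≤ τ := by linarith
    have hτ0 : 0 < τ := by linarith
    refine ⟨tailTerm_nonneg (by linarith) le_rfl hτ1, fun m i j hij => ?_⟩
    refine (prob_ucb_lt Q G γ (by linarith) tie t.isLt.le m hij (z := 2) one_lt_two).trans ?_
    rw [← hτ, Real.log_mul (by positivity) hτ0.ne', ← hl, tailTerm, zero_mul, add_zero]
    have hlogτ := Real.log_nonneg hτ1
    have hlog4 : 1 ≤ Real.log (2 ^ 2) := by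
      rw [Real.log_pow]; push_cast; linarith [Real.log_two_gt_d9]
    have h1 : (l + Real.log τ) / Real.log (2 ^ 2) ≤ l + Real.log τ :=
      div_le_self (by positivity) hlog4
    have hp1 : 1 ≤ τ ^ (0.4 : ℝ) := Real.one_le_rpow hτ1 (by norm_num)
    have h2 : Real.log τ ≤ 2.5 * τ ^ (0.4 : ℝ) := by
      have := Real.log_le_rpow_div hτ0.le (show (0 : ℝ) < 0.4 by norm_num)
      rw [div_eq_mul_inv] at this
      norm_num at this ⊢
      linarith
    have h3 : (l + Real.log τ) / Real.log (2 ^ 2) + 1 ≤ (l + 3.5) * τ ^ (0.4 : ℝ) := by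
      have : l ≤ l * τ ^ (0.4 : ℝ) := le_mul_of_one_le_right hl0 hp1
      linarith
    have h4 : τ ^ (-(α * (8 * 2 / (2 + 1) ^ 2))) ≤ τ ^ (-(1.7 * α)) :=
      Real.rpow_le_rpow_of_exponent_le hτ1 (by norm_num; linarith)
    calc _ ≤ (l + 3.5) * τ ^ (0.4 : ℝ) * τ ^ (-(1.7 * α)) := by gcongr
      _ = _ := by
        rw [mul_assoc, ← Real.rpow_add hτ0, hv]
        congr 2
        ring
  refine (prob_not_correctAfter_le hbound).trans ?_
  have hsum := sum_tailTerm_le (A := l + 3.5) (b := 0) (κ := v) (by linarith) le_rfl (by linarith) hs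
    (by simp) T
  have hs0 : 0 < s := by linarith
  have hfin : tailTerm (l + 3.5) 0 v s + tailIntegral (l + 3.5) 0 v s ≤
      2 * (l + 3.5) * s ^ (-(1.7 * α - 1.4)) := by
    rw [tailTerm, tailIntegral, zero_mul, add_zero, zero_div, add_zero,
      show -(1.7 * α - 1.4) = 1 - v by rw [hv]; ring]
    have h1 : s ^ (-v) ≤ s ^ (1 - v) := Real.rpow_le_rpow_of_exponent_le hs (by linarith)
    have h2 : (l + 3.5) / (v - 1) ≤ l + 3.5 := div_le_self (by linarith) (by linarith)
    calc _ ≤ (l + 3.5) * s ^ (1 - v) + (l + 3.5) * s ^ (1 - v) := by gcongr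
      _ = _ := by ring
  calc _ ≤ M * (K : ℝ) ^ 2 * (2 * (l + 3.5) * s ^ (-(1.7 * α - 1.4))) := by
        gcongr
        exact hsum.trans hfin
    _ ≤ M * (K : ℝ) ^ 2 * (4 * (3 + 2 * l) * s ^ (-(1.7 * α - 1.4))) := by
        refine mul_le_mul_of_nonneg_left ?_ (by positivity)
        refine mul_le_mul_of_nonneg_right ?_ (Real.rpow_nonneg hs0.le _)
        linarith
    _ = _ := by rw [sizeTerm, ← hl]; ring

/-- The failure probability in one round when `log η ≤ 2`: slices of ratio `η ^ 2` still have the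
exponent `2 α / √η`. -/
theorem prob_ucb_lt_of_log_le_two (hα : 0 ≤ α) {η : ℝ} (hη : 1 < η) (hlogη : Real.log η ≤ 2)
    {t : ℕ} (ht : t ≤ T) (m : Fin M) {i j : Fin K} (hij : i ≠ j) :
    prob (law Q G γ α tie T) {h | ucb G γ α (pre h ht) m i j < Q.q i j} ≤
      tailTerm ((Real.log ((maxDeg (powerGraph G γ) : ℝ) + 1) / 2 + 2) / Real.log η)
        (1 / 2 / Real.log η) (2 * α * η ^ (-(1 / 2) : ℝ)) ((t : ℝ) + 1) := by
  set l := Real.log ((maxDeg (powerGraph G γ) : ℝ) + 1) with hl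
  have hl0 : 0 ≤ l := Real.log_nonneg one_le_maxDeg_add_one
  set τ : ℝ := (t : ℝ) + 1 with hτ
  have hτ1 : 1 ≤ τ := by rw [hτ]; simp
  have hτ0 : 0 < τ := by linarith
  have hlogτ := Real.log_nonneg hτ1
  have hη0 : 0 < η := by linarith
  have hlη : 0 < Real.log η := Real.log_pos hη
  refine (prob_ucb_lt Q G γ hα tie ht m hij (z := η) hη).trans ?_
  rw [← hτ, Real.log_mul (by positivity) hτ0.ne', ← hl, tailTerm, Real.log_pow]
  set w := √η with hw
  have hw2 : η = w ^ 2 := (Real.sq_sqrt hη0.le).symm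
  have hw1 : 1 ≤ w := Real.one_le_sqrt.2 hη.le
  have hw3 : w ≤ 3 := by
    have h1 : η ≤ Real.exp 1 ^ 2 := by
      rw [← Real.exp_nat_mul, ← Real.log_le_iff_le_exp hη0]; simpa using hlogη
    have h2 : Real.exp 1 ≤ 3 := by linarith [Real.exp_one_lt_d9]
    rw [hw, Real.sqrt_le_left (by norm_num)]
    exact h1.trans (by gcongr)
  have hexp : 2 * α * η ^ (-(1 / 2) : ℝ) ≤ α * (8 * η / (η + 1) ^ 2) := by
    rw [Real.rpow_neg hη0.le, ← Real.sqrt_eq_rpow, ← hw, hw2, mul_comm 2 α, mul_assoc]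
    refine mul_le_mul_of_nonneg_left ?_ hα
    rw [← div_eq_mul_inv, div_le_div_iff₀ (by positivity) (by positivity)]
    -- the difference is `2 (w - 1) (w ^ 2 (3 - w) + w + 1)`
    have h1 : 0 ≤ 2 * ((w - 1) * (w ^ 2 * (3 - w) + w + 1)) := by
      have := mul_nonneg (sq_nonneg w) (sub_nonneg.2 hw3)
      have := mul_nonneg (sub_nonneg.2 hw1) (by linarith : 0 ≤ w ^ 2 * (3 - w) + w + 1)
      linarith
    linarith
  have hpow : τ ^ (-(α * (8 * η / (η + 1) ^ 2))) ≤ τ ^ (-(2 * α * η ^ (-(1 / 2) : ℝ))) :=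
    Real.rpow_le_rpow_of_exponent_le hτ1 (by linarith)
  have hcoef : (l + Real.log τ) / ((2 : ℕ) * Real.log η) + 1 ≤
      (l / 2 + 2) / Real.log η + 1 / 2 / Real.log η * Real.log τ := by
    have : (l / 2 + 2) / Real.log η + 1 / 2 / Real.log η * Real.log τ =
        (l + Real.log τ) / ((2 : ℕ) * Real.log η) + 2 / Real.log η := by
      push_cast; field_simp; ring
    rw [this]
    have : 1 ≤ 2 / Real.log η := by rwa [le_div_iff₀ hlη, one_mul]
    linarith
  gcongr

/-- The failure probability in one round when `log η > 2`: slices of ratio `η` have at least twice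
the exponent `2 α / √η`, and a failure is only possible when `log η` is bounded by the logarithm of
the number of duels, which controls the number of slices. -/
theorem prob_ucb_lt_of_two_lt_log {ε η : ℝ} (hε : 0 < ε) (hη : 1 < η)
    (hα : 0.5 * √η * (1 + ε) < α) (hlogη : 2 < Real.log η)
    {t : ℕ} (ht : t ≤ T) (hτε : Real.exp (1 / ε) ≤ (t : ℝ) + 1) (ht1 : 1 ≤ t) (m : Fin M)
    {i j : Fin K} (hij : i ≠ j) :
    prob (law Q G γ α tie T) {h | ucb G γ α (pre h ht) m i j < Q.q i j} ≤
      tailTerm ((3 / 5 * Real.log ((maxDeg (powerGraph G γ) : ℝ) + 1) + 3 / 10) / Real.log η)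
        (3 / 5 / Real.log η) (2 * α * η ^ (-(1 / 2) : ℝ)) ((t : ℝ) + 1) := by
  set D : ℝ := (maxDeg (powerGraph G γ) : ℝ) + 1 with hD
  have hD1 : 1 ≤ D := one_le_maxDeg_add_one
  set l := Real.log D with hl
  have hl0 : 0 ≤ l := Real.log_nonneg hD1
  set τ : ℝ := (t : ℝ) + 1 with hτ
  have hτ2 : 2 ≤ τ := by
    have : (1 : ℝ) ≤ t := by exact_mod_cast ht1
    rw [hτ]; linarith
  have hτ0 : 0 < τ := by linarith
  have hlogτ : 0 ≤ Real.log τ := Real.log_nonneg (by linarith)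
  have hlogτε : 1 / ε ≤ Real.log τ := (Real.le_log_iff_exp_le hτ0).2 hτε
  have hη0 : 0 < η := by linarith
  have hlη : 0 < Real.log η := by linarith
  set w := √η with hw
  have hw2 : w ^ 2 = η := Real.sq_sqrt hη0.le
  have hwlog : Real.log η = 2 * Real.log w := by rw [← hw2, Real.log_pow]; norm_num
  have hw0 : 0 < w := Real.sqrt_pos.2 hη0
  have hwe : Real.exp 1 ≤ w := by rw [← Real.le_log_iff_exp_le hw0]; linarith
  have hw1 : 2.7 ≤ w := by linarith [Real.exp_one_gt_d9]
  have hα0 : 0 < α := lt_trans (by positivity) hα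
  set κ := 2 * α * η ^ (-(1 / 2) : ℝ) with hκ
  have hκε : 1 + ε < κ := lt_exponent_of_lt hη hα
  have hκ' : κ = 2 * α / w := by
    rw [hκ, Real.rpow_neg hη0.le, ← Real.sqrt_eq_rpow, ← div_eq_mul_inv]
  have hnn : 0 ≤ tailTerm ((3 / 5 * l + 3 / 10) / Real.log η) (3 / 5 / Real.log η) κ τ :=
    tailTerm_nonneg (by positivity) (by positivity) (by linarith)
  rcases le_or_gt (D * τ) (α * Real.log τ) with hfew | hmany
  · rw [prob_ucb_lt_eq_zero Q G γ tie ht m hij hfew]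
    exact hnn
  -- a failure needs more than `α * log τ` known duels, and `α * log τ ≥ w / 2`
  have hwle : w ≤ 2 * (D * τ) := by
    have h1 : 1 ≤ (1 + ε) * Real.log τ := by
      have := mul_le_mul_of_nonneg_left hlogτε (by linarith : 0 ≤ 1 + ε)
      have h2 : (1 + ε) * (1 / ε) = 1 / ε + 1 := by field_simp
      have h3 : 0 < 1 / ε := by positivity
      linarith
    have h2 : 0.5 * w * (1 + ε) * Real.log τ ≤ α * Real.log τ := by gcongr
    nlinarith
  have hlogle : Real.log η ≤ 2 * (0.7 + l + Real.log τ) := by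
    have h1 := Real.log_le_log hw0 hwle
    rw [Real.log_mul (by norm_num) (by positivity), Real.log_mul (by positivity) hτ0.ne', ← hl] at h1
    linarith [Real.log_two_lt_d9]
  refine (prob_ucb_lt Q G γ hα0.le tie ht m hij (z := w) (by linarith)).trans ?_
  rw [← hτ, ← hD, hw2, Real.log_mul (by positivity) hτ0.ne', ← hl, tailTerm]
  -- `2 * w ^ 2 ≥ (w + 1) ^ 2` as soon as `w ≥ 1 + √2`
  have hexp : 2 * κ ≤ α * (8 * w / (w + 1) ^ 2) := by
    rw [hκ', show 2 * (2 * α / w) = α * (4 / w) by ring]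
    refine mul_le_mul_of_nonneg_left ?_ hα0.le
    rw [div_le_div_iff₀ hw0 (by positivity)]
    nlinarith
  -- the surplus factor `τ ^ (-κ)` is small because `τ ≥ 2` and `τ ^ ε ≥ exp 1`
  have hsmall : τ ^ (-κ) ≤ 1 / 5 := by
    have h1 : τ ^ (-κ) ≤ τ ^ (-(1 + ε)) :=
      Real.rpow_le_rpow_of_exponent_le (by linarith) (by linarith)
    have h2 : τ ^ (-(1 + ε)) = 1 / (τ * τ ^ ε) := by
      rw [Real.rpow_neg hτ0.le, Real.rpow_add hτ0, Real.rpow_one, one_div]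
    have h3 : Real.exp 1 ≤ τ ^ ε := by
      rw [Real.rpow_def_of_pos hτ0, Real.exp_le_exp]
      rwa [div_le_iff₀ hε] at hlogτε
    have h4 : 5 ≤ τ * τ ^ ε := by nlinarith [Real.exp_one_gt_d9]
    exact h1.trans (h2.le.trans (one_div_le_one_div_of_le (by norm_num) h4))
  have hpow : τ ^ (-(α * (8 * w / (w + 1) ^ 2))) ≤ 1 / 5 * τ ^ (-κ) := by
    calc _ ≤ τ ^ (-κ + -κ) := Real.rpow_le_rpow_of_exponent_le (by linarith) (by linarith)
      _ = τ ^ (-κ) * τ ^ (-κ) := Real.rpow_add hτ0 _ _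
      _ ≤ _ := by gcongr
  have hcoef : (l + Real.log τ) / Real.log η + 1 ≤
      5 * ((3 / 5 * l + 3 / 10) / Real.log η + 3 / 5 / Real.log η * Real.log τ) := by
    have h1 : 5 * ((3 / 5 * l + 3 / 10) / Real.log η + 3 / 5 / Real.log η * Real.log τ) =
        (3 * l + 3 / 2 + 3 * Real.log τ) / Real.log η := by field_simp; ring
    rw [h1, div_add_one hlη.ne']
    exact div_le_div_of_nonneg_right (by linarith) hlη.le
  calc _ ≤ 5 * ((3 / 5 * l + 3 / 10) / Real.log η + 3 / 5 / Real.log η * Real.log τ) *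
        (1 / 5 * τ ^ (-κ)) := by gcongr
    _ = _ := by ring

/-- The tail bound for late failures with the exponent `expo α ε η`. It is strict because the
constants from the slices leave room below `3 + 2 * log (d + 1)`. -/
theorem prob_not_correctAfter_lt (hM : 0 < M) {ε η : ℝ} (hε : 0 < ε) (hη : 1 < η)
    (hα : 0.5 * √η * (1 + ε) < α) {s : ℝ} (hs : Real.exp (1 / ε) ≤ s) (hsT : Teps ε ≤ s) :
    prob (law Q G γ α tie T) {h | ¬ CorrectAfter Q G γ α h s} <
      baseEps K G γ α η * s ^ (-(expo α ε η)) := by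
  set l := Real.log ((maxDeg (powerGraph G γ) : ℝ) + 1) with hl
  have hl0 : 0 ≤ l := Real.log_nonneg one_le_maxDeg_add_one
  have hs1 : 1 ≤ s := le_trans (Real.one_le_exp (by positivity)) hs
  have hs0 : 0 < s := by linarith
  have hlη : 0 < Real.log η := Real.log_pos hη
  have hα0 : 0 < α := lt_trans (by have := Real.sqrt_pos.2 (by linarith : 0 < η); positivity) hα
  have hκε := lt_exponent_of_lt hη hα
  have hlogs : 1 / ε ≤ Real.log s := (Real.le_log_iff_exp_le hs0).2 hs
  obtain ⟨A, b, hA, hb, hAb, hbound⟩ : ∃ A b : ℝ, 0 ≤ A ∧ 0 ≤ b ∧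
      2 * A / Real.exp 1 + 3 * b < (3 + 2 * l) / Real.log η ∧
      ∀ t : Fin T, s < (t : ℕ) + 1 → ∀ m i j, i ≠ j → prob (law Q G γ α tie T)
        {h | ucb G γ α (pre h t.isLt.le) m i j < Q.q i j} ≤
          tailTerm A b (2 * α * η ^ (-(1 / 2) : ℝ)) ((t : ℕ) + 1) := by
    have he := Real.exp_one_gt_d9
    rcases le_or_gt (Real.log η) 2 with hlog2 | hlog2
    · refine ⟨(l / 2 + 2) / Real.log η, 1 / 2 / Real.log η, by positivity, by positivity, ?_,
        fun t ht m i j hij => prob_ucb_lt_of_log_le_two hα0.le hη hlog2 t.isLt.le m hij⟩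
      rw [show 2 * ((l / 2 + 2) / Real.log η) / Real.exp 1 + 3 * (1 / 2 / Real.log η) =
        ((l + 4) / Real.exp 1 + 3 / 2) / Real.log η by field_simp; ring]
      refine div_lt_div_of_pos_right ?_ hlη
      have : (l + 4) / Real.exp 1 < 3 / 2 + 2 * l := by
        rw [div_lt_iff₀ (Real.exp_pos 1)]; nlinarith
      linarith
    · refine ⟨(3 / 5 * l + 3 / 10) / Real.log η, 3 / 5 / Real.log η, by positivity, by positivity,
        ?_, fun t ht m i j hij => prob_ucb_lt_of_two_lt_log hε hη hα hlog2 t.isLt.le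
          (by linarith) ?_ m hij⟩
      · rw [show 2 * ((3 / 5 * l + 3 / 10) / Real.log η) / Real.exp 1 + 3 * (3 / 5 / Real.log η) =
          ((6 / 5 * l + 3 / 5) / Real.exp 1 + 9 / 5) / Real.log η by field_simp; ring]
        refine div_lt_div_of_pos_right ?_ hlη
        have : (6 / 5 * l + 3 / 5) / Real.exp 1 < 6 / 5 + 2 * l := by
          rw [div_lt_iff₀ (Real.exp_pos 1)]; nlinarith
        linarith
      · by_contra h0
        have h0 : (t : ℕ) = 0 := by omega
        rw [h0] at ht
        simp only [Nat.cast_zero, zero_add] at ht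
        linarith
  have hsum := sum_tailTerm_le (A := A) (b := b) (κ := 2 * α * η ^ (-(1 / 2) : ℝ)) hA hb
    (by linarith) hs1 (by
      have h1 : 1 ≤ 2 * α * η ^ (-(1 / 2) : ℝ) * Real.log s := by
        have h2 : (1 + ε) * (1 / ε) ≤ 2 * α * η ^ (-(1 / 2) : ℝ) * Real.log s := by gcongr
        have h3 : (1 + ε) * (1 / ε) = 1 / ε + 1 := by field_simp
        have h4 : 0 < 1 / ε := by positivity
        linarith
      have := mul_le_mul_of_nonneg_left h1 hb
      linarith) T
  have hfin := tailTerm_add_tailIntegral_le hA hb hε hκε hs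
    (log_le_rpow_of_Teps_le hε hs1 hsT)
  have hle := prob_not_correctAfter_le (c := s)
    (r := tailTerm A b (2 * α * η ^ (-(1 / 2) : ℝ))) fun t ht =>
      ⟨tailTerm_nonneg hA hb (by linarith), hbound t ht⟩
  have hK : 0 < K := Nat.pos_of_ne_zero (NeZero.ne K)
  have hμ : 0 < min 1 (2 * α * η ^ (-(1 / 2) : ℝ) - 1) := lt_min one_pos (by linarith)
  calc _ ≤ M * (K : ℝ) ^ 2 * ((2 * A / Real.exp 1 + 3 * b) /
        min 1 (2 * α * η ^ (-(1 / 2) : ℝ) - 1) * s ^ (-(expo α ε η))) :=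
        hle.trans (mul_le_mul_of_nonneg_left (hsum.trans hfin) (by positivity))
    _ < M * (K : ℝ) ^ 2 * ((3 + 2 * l) / Real.log η /
        min 1 (2 * α * η ^ (-(1 / 2) : ℝ) - 1) * s ^ (-(expo α ε η))) := by gcongr
    _ = _ := by
      rw [baseEps, sizeTerm, ← hl]
      field_simp

end Failure

/-! ### From the pathwise bound to the regret bounds -/

section Final

variable {M K : ℕ} {Q : Instance K} {G : SimpleGraph (Fin M)} {γ : ℕ} {α : ℝ}

/-- `finiteTerm'` is affine in the burn-in constant. -/
theorem finiteTerm'_eq (c : ℝ) :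
    finiteTerm' Q G γ α c = finiteTerm' Q G γ α 0 + 2 * M * Q.gapMax * c := by
  simp only [finiteTerm']
  ring

theorem finiteTerm'_mono {c c' : ℝ} (h : c ≤ c') :
    finiteTerm' Q G γ α c ≤ finiteTerm' Q G γ α c' := by
  rw [finiteTerm'_eq c, finiteTerm'_eq c']
  have := Q.gapMax_nonneg
  gcongr

theorem finiteTerm'_le_finiteTerm (hK : 2 ≤ K) (hα : 0 < α) (c : ℝ) :
    finiteTerm' Q G γ α c ≤ finiteTerm Q G γ α c := by
  have hD : 0 < Q.pairSum α := pairSum_pos hK hα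
  rw [finiteTerm, finiteTerm']
  refine add_le_add_left (mul_le_mul_of_nonneg_left (Finset.sum_le_sum fun m _ => ?_)
    Q.gapMax_nonneg) _
  refine Finset.le_inf' _ _ fun γ' hγ' => (Finset.inf'_le _ hγ').trans ?_
  have hΓ : (1 : ℝ) ≤ maxCliqueAt (powerGraph G γ') m := by exact_mod_cast one_le_maxCliqueAt _ m
  have hlog : Real.log (2 * Q.pairSum α / (maxCliqueAt (powerGraph G γ') m : ℝ)) ≤
      Real.log (2 * Q.pairSum α) :=
    Real.log_le_log (by positivity) (div_le_self (by positivity) hΓ)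
  gcongr

/-- With a single arm all gaps vanish, and both sides of the regret bounds are zero. -/
theorem gap_eq_zero_of_lt_two (hK : K < 2) (j : Fin K) : Q.gap j = 0 := by
  have : j = Q.cw := by
    have h1 := j.isLt
    have h2 := Q.cw.isLt
    exact Fin.ext (by omega)
  rw [this, Q.gap_cw]

theorem gapMax_eq_zero_of_lt_two (hK : K < 2) : Q.gapMax = 0 :=
  le_antisymm (Finset.sup'_le _ _ fun j _ => (gap_eq_zero_of_lt_two hK j).le) Q.gapMax_nonneg

theorem regret_eq_zero_of_lt_two (hK : K < 2) {T : ℕ} (h : History M K T) : regret Q h = 0 := by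
  simp [regret, gap_eq_zero_of_lt_two hK]

theorem leadTerm_eq_zero_of_lt_two (hK : K < 2) (T : ℕ) : leadTerm Q G γ α T = 0 := by
  simp [leadTerm, gap_eq_zero_of_lt_two hK]

/-- The two parts of the tail integral, optimized at `B ^ (1 / x)`. -/
theorem add_tail_le {B x s s₀ : ℝ} (hB : 0 < B) (hx : 1 < x) (hs : B ^ (1 / x) ≤ s)
    (hs₀ : s ≤ s₀ + B ^ (1 / x)) :
    s + B * s ^ (1 - x) / (x - 1) ≤ s₀ + x / (x - 1) * B ^ (1 / x) := by
  set ρ := B ^ (1 / x) with hρ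
  have hρ0 : 0 < ρ := Real.rpow_pos_of_pos hB _
  have hx1 : 0 < x - 1 := by linarith
  have hBρ : B = ρ ^ x := by
    rw [hρ, ← Real.rpow_mul hB.le, one_div_mul_cancel (by linarith), Real.rpow_one]
  have h1 : B * s ^ (1 - x) ≤ ρ := by
    calc B * s ^ (1 - x) ≤ B * ρ ^ (1 - x) :=
          mul_le_mul_of_nonneg_left (Real.rpow_le_rpow_of_nonpos hρ0 hs (by linarith)) hB.le
      _ = ρ := by rw [hBρ, ← Real.rpow_add hρ0]; simp
  have h2 : B * s ^ (1 - x) / (x - 1) ≤ ρ / (x - 1) := div_le_div_of_nonneg_right h1 hx1.le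
  have h3 : x / (x - 1) * ρ = ρ + ρ / (x - 1) := by field_simp; ring
  linarith

variable [NeZero K] {tie : TieRule M K} {T : ℕ}

theorem expectedRegret_eq_zero_of_lt_two (hK : K < 2) : expectedRegret Q G γ α tie T = 0 := by
  rw [expectedRegret, funext (regret_eq_zero_of_lt_two hK), expect_const]

/-- In expectation, the last failing round takes the place of the burn-in constant. -/
theorem expectedRegret_le_of_tail (hK : 2 ≤ K) (htie : tie.Valid) (hα : 0 < α) {s x B C : ℝ}
    (hs : 0 < s) (hx : 1 < x) (hB : 0 ≤ B)
    (htail : ∀ u, s ≤ u →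
      prob (law Q G γ α tie T) {h | ¬ CorrectAfter Q G γ α h u} ≤ B * u ^ (-x))
    (hC : s + B * s ^ (1 - x) / (x - 1) ≤ C) :
    expectedRegret Q G γ α tie T ≤ leadTerm Q G γ α T + finiteTerm' Q G γ α C := by
  have hE := expect_le_of_tail (law Q G γ α tie T) (fun h => (lastFailure Q G γ α h : ℝ)) hs hx hB
    fun u hu => by
      rw [lt_lastFailure_eq (hs.le.trans hu)]
      exact htail u hu
  have hreg : expectedRegret Q G γ α tie T ≤ expect (law Q G γ α tie T) fun h =>
      (leadTerm Q G γ α T + finiteTerm' Q G γ α 0) +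
        2 * M * Q.gapMax * (lastFailure Q G γ α h : ℝ) :=
    expect_mono_of_support fun h hh => by
      have := regret_le hh htie hK hα (Nat.cast_nonneg _)
        ((correctAfter_iff (Nat.cast_nonneg _)).2 le_rfl)
      rw [finiteTerm'_eq] at this
      linarith
  rw [expect_add, expect_const, expect_const_mul] at hreg
  rw [finiteTerm'_eq C]
  have h2 : 2 * M * Q.gapMax * expect (law Q G γ α tie T)
      (fun h => (lastFailure Q G γ α h : ℝ)) ≤ 2 * M * Q.gapMax * C :=
    mul_le_mul_of_nonneg_left (hE.trans hC) (by have := Q.gapMax_nonneg; positivity)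
  linarith

theorem expectedRegret_le_of_lt (hM : 0 < M) (htie : tie.Valid) (hα : 2.4 / 1.7 < α) :
    expectedRegret Q G γ α tie T ≤
      leadTerm Q G γ α T + finiteTerm Q G γ α (Ctilde K G γ α) := by
  have hα0 : 0 < α := lt_trans (by norm_num) hα
  rcases lt_or_ge K 2 with hK | hK
  · simp [expectedRegret_eq_zero_of_lt_two hK, leadTerm_eq_zero_of_lt_two hK, finiteTerm,
      gapMax_eq_zero_of_lt_two hK]
  have hα' : 2.4 < 1.7 * α := by rw [div_lt_iff₀ (by norm_num)] at hα; linarith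
  have hlog : 0 ≤ Real.log ((maxDeg (powerGraph G γ) : ℝ) + 1) :=
    Real.log_nonneg one_le_maxDeg_add_one
  have hS : 1 ≤ 4 * sizeTerm K G γ := by
    have h1 : (1 : ℝ) ≤ M := by exact_mod_cast hM
    have h2 : (1 : ℝ) ≤ (K : ℝ) ^ 2 := by
      exact_mod_cast Nat.one_le_pow 2 K (by omega)
    have h3 : (1 : ℝ) ≤ M * (K : ℝ) ^ 2 := by nlinarith
    rw [sizeTerm]
    nlinarith
  have hx : 1 < 1.7 * α - 1.4 := by linarith
  set x := 1.7 * α - 1.4 with hxdef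
  have hs1 : 1 ≤ (4 * sizeTerm K G γ) ^ (1 / x) := Real.one_le_rpow hS (by positivity)
  refine (expectedRegret_le_of_tail hK htie hα0 (by linarith) hx (by linarith)
    (fun u hu => prob_not_correctAfter_le_of_one_le hα (hs1.trans hu))
    (add_tail_le (s₀ := 0) (by linarith) hx le_rfl (by simp))).trans ?_
  refine add_le_add_right ((finiteTerm'_mono (le_of_eq ?_)).trans
    (finiteTerm'_le_finiteTerm hK hα0 _)) _
  rw [Ctilde, ← hxdef, zero_add, show 1.7 * α - 2.4 = x - 1 by rw [hxdef]; ring]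

theorem baseEps_pos (hM : 0 < M) {η κ : ℝ} (hη : 1 < η)
    (hκ : κ < 2 * α * η ^ (-(1 / 2) : ℝ)) (hκ1 : 1 ≤ κ) : 0 < baseEps K G γ α η :=
  div_pos (sizeTerm_pos hM) (mul_pos (lt_min one_pos (by linarith)) (Real.log_pos hη))

theorem lt_prob_regret_le (hM : 0 < M) (htie : tie.Valid) {ε η δ : ℝ} (hε : 0 < ε) (hη : 1 < η)
    (hδ : 0 < δ) (hα : 0.5 * √η * (1 + ε) < α) :
    1 - δ < prob (law Q G γ α tie T) {h | regret Q h ≤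
      leadTerm Q G γ α T + finiteTerm' Q G γ α (Ceps K G γ α ε η δ)} := by
  have hα0 : 0 < α := lt_trans (by have := Real.sqrt_pos.2 (by linarith : 0 < η); positivity) hα
  set s := Ceps K G γ α ε η δ with hs
  have hκ := lt_exponent_of_lt hη hα
  have hx : 0 < expo α ε η := by rw [expo]; linarith
  have hB : 0 < baseEps K G γ α η := baseEps_pos hM hη hκ (by linarith)
  have hs1 : Real.exp (1 / ε) ≤ s := (le_max_left _ _).trans (le_max_left _ _)
  have hs2 : Teps ε ≤ s := (le_max_right _ _).trans (le_max_left _ _)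
  have hs3 : (baseEps K G γ α η / δ) ^ (1 / expo α ε η) ≤ s := le_max_right _ _
  have hs0 : 0 < s := (Real.exp_pos _).trans_le hs1
  have hfail := prob_not_correctAfter_lt (Q := Q) (G := G) (γ := γ) (tie := tie) (T := T)
    hM hε hη hα hs1 hs2
  have hle : baseEps K G γ α η * s ^ (-expo α ε η) ≤ δ := by
    have h1 := Real.rpow_le_rpow (by positivity) hs3 hx.le
    rw [← Real.rpow_mul (by positivity), one_div_mul_cancel hx.ne', Real.rpow_one,
      div_le_iff₀ hδ] at h1
    rw [Real.rpow_neg hs0.le, ← div_eq_mul_inv, div_le_iff₀ (Real.rpow_pos_of_pos hs0 _)]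
    linarith
  have hmono : prob (law Q G γ α tie T) {h | ¬ CorrectAfter Q G γ α h s}ᶜ ≤
      prob (law Q G γ α tie T) {h | regret Q h ≤
        leadTerm Q G γ α T + finiteTerm' Q G γ α s} := by
    refine prob_mono_of_support fun h hh hcor => ?_
    rcases lt_or_ge K 2 with hK | hK
    · simp [regret_eq_zero_of_lt_two hK, leadTerm_eq_zero_of_lt_two hK, finiteTerm',
        gapMax_eq_zero_of_lt_two hK]
    · exact regret_le hh htie hK hα0 hs0.le (not_not.1 hcor)
  rw [prob_compl] at hmono
  linarith

theorem expectedRegret_le_of_mul_sqrt_lt (hM : 0 < M) (htie : tie.Valid) {ε η : ℝ} (hε : 0 < ε)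
    (hη : 1 < η) (hα : 0.5 * √η * (2 + ε) < α) :
    expectedRegret Q G γ α tie T ≤
      leadTerm Q G γ α T + finiteTerm' Q G γ α (CtildeEps K G γ α ε η) := by
  have hsq : 0 < √η := Real.sqrt_pos.2 (by linarith)
  have hα0 : 0 < α := lt_trans (by positivity) hα
  have hα1 : 0.5 * √η * (1 + ε) < α := lt_trans (by gcongr; norm_num) hα
  rcases lt_or_ge K 2 with hK | hK
  · simp [expectedRegret_eq_zero_of_lt_two hK, leadTerm_eq_zero_of_lt_two hK, finiteTerm',
      gapMax_eq_zero_of_lt_two hK]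
  have hκ := lt_exponent_of_lt hη hα
  have hx : 1 < expo α ε η := by rw [expo]; linarith
  have hB : 0 < baseEps K G γ α η := baseEps_pos hM hη hκ (by linarith)
  have hρ : 0 < baseEps K G γ α η ^ (1 / expo α ε η) := Real.rpow_pos_of_pos hB _
  set s₀ := max (Teps ε) (Real.exp (1 / ε)) with hs₀
  have hs₀0 : 0 < s₀ := (Real.exp_pos _).trans_le (le_max_right _ _)
  exact expectedRegret_le_of_tail hK htie hα0 (s := max s₀ (baseEps K G γ α η ^ (1 / expo α ε η)))
    (hs₀0.trans_le (le_max_left _ _)) hx hB.le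
    (fun u hu => (prob_not_correctAfter_lt hM hε hη hα1
      ((le_max_right _ _).trans ((le_max_left _ _).trans hu))
      ((le_max_left _ _).trans ((le_max_left _ _).trans hu))).le)
    (add_tail_le hB hx (le_max_right _ _) (max_le (by linarith) (by linarith)))

end Final

end MPDueling

theorem theorem3 {M K : ℕ} [NeZero K] (Q : MPDueling.Instance K)
    (G : SimpleGraph (Fin M)) (hG : G.Connected) (γ : ℕ)
    (tie : MPDueling.TieRule M K) (htie : tie.Valid) :
    (∀ α : ℝ, 2.4 / 1.7 < α → ∀ T : ℕ,
      MPDueling.expectedRegret Q G γ α tie T ≤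
        MPDueling.leadTerm Q G γ α T +
          MPDueling.finiteTerm Q G γ α (MPDueling.Ctilde K G γ α)) ∧
    (∀ ε η δ α : ℝ, 0 < ε → 1 < η → 0 < δ → 0.5 * √η * (1 + ε) < α → ∀ T : ℕ,
      1 - δ < MPDueling.prob (MPDueling.law Q G γ α tie T)
        {h | MPDueling.regret Q h ≤
          MPDueling.leadTerm Q G γ α T +
            MPDueling.finiteTerm' Q G γ α (MPDueling.Ceps K G γ α ε η δ)}) ∧
    (∀ ε η α : ℝ, 0 < ε → 1 < η → 0.5 * √η * (2 + ε) < α → ∀ T : ℕ,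
      MPDueling.expectedRegret Q G γ α tie T ≤
        MPDueling.leadTerm Q G γ α T +
          MPDueling.finiteTerm' Q G γ α (MPDueling.CtildeEps K G γ α ε η)) := by
  have hM : 0 < M := Fin.pos_iff_nonempty.2 hG.nonempty
  exact ⟨fun α hα T => MPDueling.expectedRegret_le_of_lt hM htie hα,
    fun ε η δ α hε hη hδ hα T => MPDueling.lt_prob_regret_le hM htie hε hη hδ hα,
    fun ε η α hε hη hα T => MPDueling.expectedRegret_le_of_mul_sqrt_lt hM htie hε hη hα⟩
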